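/- All manifolds are smooth, Hausdorff, finite-dimensional and without boundary. Let $\Sigma\rightrightarrows X$ be a Lie groupoid with source $s$, target $t$, units $u$, inversion $\tau$ and multiplication $m:\Sigma^{(2)}\to\Sigma$, $m(g_1,g_2)=g_1g_2$, where $\Sigma^{(2)}=\{(g_1,g_2): s(g_1)=t(g_2)\}$ is an embedded submanifold of $\Sigma\times\Sigma$; write $t(g_1,g_2)=t(g_1)$, and $\mathrm{pr}_1,\mathrm{pr}_2:\Sigma^{(2)}\to\Sigma$ for the projections. An Ehresmann connection on a submersion $t:P\to X$ is a smooth sub-bundle $\mathcal C\subset TP$ complementary to $\ker dt$; let $\mathrm{hor}^{\mathcal C}$ be its horizontal lifting, and for a smooth section $c$ of $t^*\Lambda^qT^*X$, i.e. a horizontal form $\bar c=c(dt\,\cdot,\dots,dt\,\cdot)$ on $P$, let $d_{\mathcal C}c=(d_{DR}\bar c)(\mathrm{hor}^{\mathcal C}\cdot,\dots,\mathrm{hor}^{\mathcal C}\cdot)$. Put $C^0=\Omega^q(X)$ and $C^p(\Sigma,\Lambda^qT^*X)=\Gamma(\Sigma^{(p)},t^*\Lambda^qT^*X)$ for $p=1,2$.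 Let $\Sigma$ act smoothly and linearly on the vector bundle $TX$, and put $g^*v=g^{-1}\cdot v$ for $v\in T_{t(g)}X$, with the induced action $(g\cdot\alpha)(v_1,\dots,v_q)=\alpha(g^*v_1,\dots,g^*v_q)$ on $\Lambda^qT^*X$. Let $\delta$ be the groupoid differential: $(\delta\alpha)(g)=g\cdot\alpha_{s(g)}-\alpha_{t(g)}$ and $(\delta c)(g_1,g_2)=g_1\cdot c(g_2)-c(g_1g_2)+c(g_1)$. Let $\mathcal C$ be an Ehresmann connection on $t:\Sigma\to X$ and $\mathcal C^{(2)}$ an Ehresmann connection on $t:\Sigma^{(2)}\to X$. Assume: (a) the action is compatible with $\mathcal C$: $d_{\mathcal C}(\delta\alpha)=\delta(d_{DR}\alpha)$ for all $q\ge 0$ and all $\alpha\in\Omega^q(X)$; (b) the derivation identity $d_{\mathcal C^{(2)}}(f_1\cup f_2)=d_{\mathcal C}f_1\cup f_2+f_1\cup d_{\mathcal C}f_2$ holds for all $f_1,f_2\in C^\infty(\Sigma)$, where $(f_1\cup f_2)(g_1,g_2)=f_1(g_1)f_2(g_2)$, $(\theta\cup f)(g_1,g_2)=f(g_2)\,\theta(g_1)$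 and $(f\cup\theta)(g_1,g_2)=f(g_1)\;g_1\cdot\theta(g_2)$. Then $\mathcal C^{(2)}$ is determined by $\mathcal C$: $\mathcal C^{(2)}=\{\xi\in T\Sigma^{(2)}: d\mathrm{pr}_1\xi\in\mathcal C,\ d\mathrm{pr}_2\xi\in\mathcal C\}$. Moreover the following are equivalent: (i) $d_{\mathcal C^{(2)}}(\delta c)=\delta(d_{\mathcal C}c)$ for all $q\ge0$ and all $c\in C^1(\Sigma,\Lambda^qT^*X)$; (ii) $\mathcal C$ is multiplicative, i.e. a subgroupoid of the tangent groupoid $T\Sigma\rightrightarrows TX$ with all of $TX$ as objects: (m1) $ds:\mathcal C_g\to T_{s(g)}X$ and $dt:\mathcal C_g\to T_{t(g)}X$ are surjective for all $g$; (m2) $dm(v,w)\in\mathcal C$ for all $v,w\in\mathcal C$ with $ds(v)=dt(w)$; (m3) $du(T_xX)\subset\mathcal C_{u(x)}$ for all $x\in X$; (m4) $d\tau(\mathcal C)\subset\mathcal C$; (iii) condition (m2) holds. -/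

import Mathlib

open scoped Manifold ContDiff Topology

noncomputable section

section Forms

variable {EP : Type*} [NormedAddCommGroup EP] [NormedSpace ℝ EP]
  {P : Type*} [TopologicalSpace P] [ChartedSpace EP P]
  {EX : Type*} [NormedAddCommGroup EX] [NormedSpace ℝ EX]
  {X : Type*} [TopologicalSpace X] [ChartedSpace EX X]

/-- The identification of the tangent spaces at two equal points. -/
def tangentCast {x y : X} (h : x = y) :
    TangentSpace 𝓘(ℝ, EX) x →L[ℝ] TangentSpace 𝓘(ℝ, EX) y :=
  h ▸ ContinuousLinearMap.id ℝ (TangentSpace 𝓘(ℝ, EX) x)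

/-- The exterior derivative of a differential `q`-form on a manifold without boundary, at the
point `p`: read the form in the preferred chart around `p`, take the exterior derivative in the
model space and transport the result back to `T_p P`. -/
def mExtDeriv {q : ℕ} (η : ∀ p : P, TangentSpace 𝓘(ℝ, EP) p [⋀^Fin q]→L[ℝ] ℝ) (p : P) :
    TangentSpace 𝓘(ℝ, EP) p [⋀^Fin (q + 1)]→L[ℝ] ℝ :=
  (extDeriv (E := EP) (F := ℝ) (fun y : EP =>
      (η ((extChartAt 𝓘(ℝ, EP) p).symm y)).compContinuousLinearMap
        (mfderiv 𝓘(ℝ, EP) 𝓘(ℝ, EP) (extChartAt 𝓘(ℝ, EP) p).symm y))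
    (extChartAt 𝓘(ℝ, EP) p p)).compContinuousLinearMap
      (mfderiv 𝓘(ℝ, EP) 𝓘(ℝ, EP) (extChartAt 𝓘(ℝ, EP) p) p)

/-- Smoothness of a section `c` of `τ^* Λ^q T^*X` over `P`: around each point `p₀`, written in
the frame of `TX` given by the chart of `X` at `τ p₀`, the coefficients are smooth. For `τ = id`
this is smoothness of differential `q`-forms on `X`. -/
def IsSmoothCochain [IsManifold 𝓘(ℝ, EX) ∞ X] {q : ℕ} (τ : P → X)
    (c : ∀ p : P, TangentSpace 𝓘(ℝ, EX) (τ p) [⋀^Fin q]→L[ℝ] ℝ) : Prop :=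
  ∀ p₀ : P, ContMDiffAt 𝓘(ℝ, EP) 𝓘(ℝ, EX [⋀^Fin q]→L[ℝ] ℝ) ∞
    (fun p : P => ContinuousAlternatingMap.compContinuousLinearMap (M := EX) (c p)
      (tangentCoordChange 𝓘(ℝ, EX) (τ p₀) (τ p) (τ p))) p₀

/-- A family of subspaces of the tangent spaces is a smooth sub-bundle of `TP`: locally it has a
frame of smooth vector fields. -/
def IsSmoothSubbundle [IsManifold 𝓘(ℝ, EP) ∞ P]
    (C : ∀ p : P, Submodule ℝ (TangentSpace 𝓘(ℝ, EP) p)) : Prop :=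
  ∀ p₀ : P, ∃ U : Set P, IsOpen U ∧ p₀ ∈ U ∧ ∃ (k : ℕ)
    (V : Fin k → ∀ p : P, TangentSpace 𝓘(ℝ, EP) p),
    (∀ i, ContMDiffOn 𝓘(ℝ, EP) 𝓘(ℝ, EP).tangent ∞
      (fun p : P => (⟨p, V i p⟩ : TangentBundle 𝓘(ℝ, EP) P)) U) ∧
    ∀ p ∈ U, LinearIndependent ℝ (fun i => V i p) ∧
      Submodule.span ℝ (Set.range fun i => V i p) = C p

variable (EP EX) in
/-- An Ehresmann connection on `τ : P → X`: a smooth sub-bundle of `TP` complementary to the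
vertical bundle `ker dτ`. -/
structure EhresmannConnection [IsManifold 𝓘(ℝ, EP) ∞ P] (τ : P → X) where
  fiber : ∀ p : P, Submodule ℝ (TangentSpace 𝓘(ℝ, EP) p)
  smooth : IsSmoothSubbundle fiber
  isCompl : ∀ p : P, IsCompl (fiber p)
    (LinearMap.ker (mfderiv 𝓘(ℝ, EP) 𝓘(ℝ, EX) τ p).toLinearMap)

namespace EhresmannConnection

variable [IsManifold 𝓘(ℝ, EP) ∞ P] {τ : P → X} (C : EhresmannConnection EP EX τ)

theorem ker_restrict (p : P) :
    LinearMap.ker ((mfderiv 𝓘(ℝ, EP) 𝓘(ℝ, EX) τ p).toLinearMap ∘ₗ (C.fiber p).subtype) = ⊥ := by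
  rw [LinearMap.ker_eq_bot']
  rintro ⟨w, hw⟩ h
  have : w ∈ C.fiber p ⊓ LinearMap.ker (mfderiv 𝓘(ℝ, EP) 𝓘(ℝ, EX) τ p).toLinearMap := ⟨hw, h⟩
  rw [(C.isCompl p).inf_eq_bot] at this
  exact Subtype.ext this

variable [FiniteDimensional ℝ EX]

/-- Horizontal lifting `T_{τ p} X → T_p P`: the inverse of the restriction of `dτ` to the
connection. (It is built as a left inverse; `dτ` restricted to the connection is bijective
whenever `τ` is a submersion.) -/
def hor (p : P) : TangentSpace 𝓘(ℝ, EX) (τ p) →L[ℝ] TangentSpace 𝓘(ℝ, EP) p :=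
  haveI : FiniteDimensional ℝ (TangentSpace 𝓘(ℝ, EX) (τ p)) :=
    inferInstanceAs (FiniteDimensional ℝ EX)
  haveI : T2Space (TangentSpace 𝓘(ℝ, EX) (τ p)) := inferInstanceAs (T2Space EX)
  LinearMap.toContinuousLinearMap ((C.fiber p).subtype ∘ₗ
    Classical.choose (LinearMap.exists_leftInverse_of_injective _ (C.ker_restrict p)))

theorem hor_mfderiv (p : P) {w : TangentSpace 𝓘(ℝ, EP) p} (hw : w ∈ C.fiber p) :
    C.hor p (mfderiv 𝓘(ℝ, EP) 𝓘(ℝ, EX) τ p w) = w := by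
  have h := Classical.choose_spec
    (LinearMap.exists_leftInverse_of_injective _ (C.ker_restrict p))
  exact congrArg Subtype.val (LinearMap.congr_fun h ⟨w, hw⟩)

theorem hor_mem (p : P) (v : TangentSpace 𝓘(ℝ, EX) (τ p)) : C.hor p v ∈ C.fiber p :=
  (Classical.choose (LinearMap.exists_leftInverse_of_injective _ (C.ker_restrict p)) v).2

theorem mfderiv_hor (p : P)
    (hτ : Function.Surjective (mfderiv 𝓘(ℝ, EP) 𝓘(ℝ, EX) τ p))
    (v : TangentSpace 𝓘(ℝ, EX) (τ p)) :
    mfderiv 𝓘(ℝ, EP) 𝓘(ℝ, EX) τ p (C.hor p v) = v := by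
  obtain ⟨w, rfl⟩ := hτ v
  have hw : w ∈ C.fiber p ⊔ LinearMap.ker (mfderiv 𝓘(ℝ, EP) 𝓘(ℝ, EX) τ p).toLinearMap := by
    rw [(C.isCompl p).sup_eq_top]; trivial
  obtain ⟨a, ha, b, hb, rfl⟩ := Submodule.mem_sup.1 hw
  have hb' : mfderiv 𝓘(ℝ, EP) 𝓘(ℝ, EX) τ p b = 0 := hb
  rw [map_add, hb', add_zero, C.hor_mfderiv p ha]

/-- The operator `d_C` on sections of `τ^* Λ^q T^*X`: regard the section as the horizontal form
`c(dτ -, …, dτ -)` on `P`, and evaluate its exterior derivative on horizontal lifts. -/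
def d {q : ℕ} (c : ∀ p : P, TangentSpace 𝓘(ℝ, EX) (τ p) [⋀^Fin q]→L[ℝ] ℝ) (p : P) :
    TangentSpace 𝓘(ℝ, EX) (τ p) [⋀^Fin (q + 1)]→L[ℝ] ℝ :=
  (mExtDeriv (fun p' : P => (c p').compContinuousLinearMap (mfderiv 𝓘(ℝ, EP) 𝓘(ℝ, EX) τ p'))
    p).compContinuousLinearMap (C.hor p)

end EhresmannConnection

end Forms

/-- A groupoid with space of objects `X` and space of arrows `G`; the product `g h` is defined
when `src g = tgt h`. -/
structure GroupoidOn (X G : Type*) where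
  src : G → X
  tgt : G → X
  unit : X → G
  inv : G → G
  mul : {a : G × G // src a.1 = tgt a.2} → G
  src_unit : ∀ x, src (unit x) = x
  tgt_unit : ∀ x, tgt (unit x) = x
  src_inv : ∀ g, src (inv g) = tgt g
  tgt_inv : ∀ g, tgt (inv g) = src g
  src_mul : ∀ a, src (mul a) = src a.1.2
  tgt_mul : ∀ a, tgt (mul a) = tgt a.1.1
  mul_assoc : ∀ (g h k : G) (hgh : src g = tgt h) (hhk : src h = tgt k),
    mul ⟨(mul ⟨(g, h), hgh⟩, k), (src_mul ⟨(g, h), hgh⟩).trans hhk⟩ =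
      mul ⟨(g, mul ⟨(h, k), hhk⟩), hgh.trans (tgt_mul ⟨(h, k), hhk⟩).symm⟩
  unit_mul : ∀ g, mul ⟨(unit (tgt g), g), src_unit _⟩ = g
  mul_unit : ∀ g, mul ⟨(g, unit (src g)), (tgt_unit _).symm⟩ = g
  inv_mul : ∀ g, mul ⟨(inv g, g), src_inv g⟩ = unit (src g)
  mul_inv : ∀ g, mul ⟨(g, inv g), (tgt_inv g).symm⟩ = unit (tgt g)

namespace GroupoidOn

variable {X G : Type*}

/-- The space of composable pairs of arrows, a subspace of `G × G`. -/
abbrev Composable (S : GroupoidOn X G) : Type _ := {a : G × G // S.src a.1 = S.tgt a.2}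

variable (S : GroupoidOn X G)

/-- The first arrow of a composable pair. -/
abbrev pr₁ (a : S.Composable) : G := a.1.1

/-- The second arrow of a composable pair. -/
abbrev pr₂ (a : S.Composable) : G := a.1.2

/-- The target of the first arrow of a composable pair. -/
abbrev tgt₂ (a : S.Composable) : X := S.tgt (S.pr₁ a)

theorem src_pr₁ (a : S.Composable) : S.src (S.pr₁ a) = S.tgt (S.pr₂ a) := a.2

theorem tgt₂_eq (a : S.Composable) : S.tgt₂ a = S.tgt (S.mul a) := (S.tgt_mul a).symm

variable {EX : Type*} [NormedAddCommGroup EX] [NormedSpace ℝ EX]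
  [TopologicalSpace X] [ChartedSpace EX X]
  {EG : Type*} [NormedAddCommGroup EG] [NormedSpace ℝ EG]
  [TopologicalSpace G] [ChartedSpace EG G]
  {E₂ : Type*} [NormedAddCommGroup E₂] [NormedSpace ℝ E₂]

variable (EX EG E₂) in
/-- `S` is a Lie groupoid: source and target are submersions, the other structure maps are smooth.
The space of composable pairs carries its manifold structure of embedded submanifold of `G × G`
(such a structure exists because source and target are submersions, and is unique). -/
structure IsLie [ChartedSpace E₂ S.Composable] : Prop where
  src_submersion : Manifold.IsSubmersion 𝓘(ℝ, EG) 𝓘(ℝ, EX) ∞ S.src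
  tgt_submersion : Manifold.IsSubmersion 𝓘(ℝ, EG) 𝓘(ℝ, EX) ∞ S.tgt
  unit_smooth : ContMDiff 𝓘(ℝ, EX) 𝓘(ℝ, EG) ∞ S.unit
  inv_smooth : ContMDiff 𝓘(ℝ, EG) 𝓘(ℝ, EG) ∞ S.inv
  composable_embedded : Manifold.IsSmoothEmbedding 𝓘(ℝ, E₂) (𝓘(ℝ, EG).prod 𝓘(ℝ, EG)) ∞
    (Subtype.val : S.Composable → G × G)
  mul_smooth : ContMDiff 𝓘(ℝ, E₂) 𝓘(ℝ, EG) ∞ S.mul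

variable (EX EG) in
/-- A (smooth, linear) action of the groupoid on the vector bundle `TX`. -/
structure TangentAction [IsManifold 𝓘(ℝ, EX) ∞ X] where
  act : ∀ g : G, TangentSpace 𝓘(ℝ, EX) (S.src g) →L[ℝ] TangentSpace 𝓘(ℝ, EX) (S.tgt g)
  act_unit : ∀ (x : X) (v : TangentSpace 𝓘(ℝ, EX) x),
    act (S.unit x) (tangentCast (S.src_unit x).symm v) = tangentCast (S.tgt_unit x).symm v
  act_mul : ∀ (a : S.Composable) (v : TangentSpace 𝓘(ℝ, EX) (S.src (S.pr₂ a))),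
    act (S.mul a) (tangentCast (S.src_mul a).symm v) =
      tangentCast (S.tgt_mul a).symm
        (act (S.pr₁ a) (tangentCast (S.src_pr₁ a).symm (act (S.pr₂ a) v)))
  smooth : ∀ g₀ : G, ContMDiffAt 𝓘(ℝ, EG) 𝓘(ℝ, EX →L[ℝ] EX) ∞
    (inTangentCoordinates 𝓘(ℝ, EX) 𝓘(ℝ, EX) S.src S.tgt act g₀) g₀

section Differentials

variable {S} [IsManifold 𝓘(ℝ, EX) ∞ X] (A : S.TangentAction EX EG)

/-- The right action `g^* : T_{t(g)} X → T_{s(g)} X` of an arrow, `g^* v = g⁻¹ · v`. -/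
def TangentAction.pull (g : G) :
    TangentSpace 𝓘(ℝ, EX) (S.tgt g) →L[ℝ] TangentSpace 𝓘(ℝ, EX) (S.src g) :=
  tangentCast (S.tgt_inv g) ∘L A.act (S.inv g) ∘L tangentCast (S.src_inv g).symm

/-- The term `g₁ · c(g₂)`, for the induced action on `Λ^q T^*X`. -/
def TangentAction.shift {q : ℕ}
    (c : ∀ g : G, TangentSpace 𝓘(ℝ, EX) (S.tgt g) [⋀^Fin q]→L[ℝ] ℝ) (a : S.Composable) :
    TangentSpace 𝓘(ℝ, EX) (S.tgt₂ a) [⋀^Fin q]→L[ℝ] ℝ :=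
  (c (S.pr₂ a)).compContinuousLinearMap (tangentCast (S.src_pr₁ a) ∘L A.pull (S.pr₁ a))

/-- The groupoid differential on `0`-cochains, `(δα)(g) = g · α(s g) - α(t g)`. -/
def TangentAction.δ₀ {q : ℕ} (α : ∀ x : X, TangentSpace 𝓘(ℝ, EX) x [⋀^Fin q]→L[ℝ] ℝ) (g : G) :
    TangentSpace 𝓘(ℝ, EX) (S.tgt g) [⋀^Fin q]→L[ℝ] ℝ :=
  (α (S.src g)).compContinuousLinearMap (A.pull g) - α (S.tgt g)

/-- The groupoid differential on `1`-cochains,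
`(δc)(g₁, g₂) = g₁ · c(g₂) - c(g₁ g₂) + c(g₁)`. -/
def TangentAction.δ₁ {q : ℕ}
    (c : ∀ g : G, TangentSpace 𝓘(ℝ, EX) (S.tgt g) [⋀^Fin q]→L[ℝ] ℝ) (a : S.Composable) :
    TangentSpace 𝓘(ℝ, EX) (S.tgt₂ a) [⋀^Fin q]→L[ℝ] ℝ :=
  A.shift c a - (c (S.mul a)).compContinuousLinearMap (tangentCast (S.tgt₂_eq a)) + c (S.pr₁ a)

variable [IsManifold 𝓘(ℝ, EG) ∞ G] [FiniteDimensional ℝ EX]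

/-- `δ` and `d` commute between the rows of `0`-cochains and `1`-cochains, in all form degrees. -/
def CommutesRow₀₁ (C : EhresmannConnection EG EX S.tgt) : Prop :=
  ∀ (q : ℕ) (α : ∀ x : X, TangentSpace 𝓘(ℝ, EX) x [⋀^Fin q]→L[ℝ] ℝ),
    IsSmoothCochain (EP := EX) (fun x : X => x) α → C.d (A.δ₀ α) = A.δ₀ (mExtDeriv α)

variable [ChartedSpace E₂ S.Composable] [IsManifold 𝓘(ℝ, E₂) ∞ S.Composable]

/-- `δ` and `d` commute between the rows of `1`-cochains and `2`-cochains, in all form degrees. -/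
def CommutesRow₁₂ (C : EhresmannConnection EG EX S.tgt)
    (C₂ : EhresmannConnection E₂ EX S.tgt₂) : Prop :=
  ∀ (q : ℕ) (c : ∀ g : G, TangentSpace 𝓘(ℝ, EX) (S.tgt g) [⋀^Fin q]→L[ℝ] ℝ),
    IsSmoothCochain (EP := EG) S.tgt c → C₂.d (A.δ₁ c) = A.δ₁ (C.d c)

/-- A function, viewed as a section of `τ^* Λ^0 T^*X`. -/
def zeroCochain {P : Type*} (τ : P → X) (f : P → ℝ) (p : P) :
    TangentSpace 𝓘(ℝ, EX) (τ p) [⋀^Fin 0]→L[ℝ] ℝ :=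
  ContinuousAlternatingMap.constOfIsEmpty ℝ (TangentSpace 𝓘(ℝ, EX) (τ p)) (Fin 0) (f p)

/-- The derivation identity `d(f₁ ∪ f₂) = d f₁ ∪ f₂ + f₁ ∪ d f₂` for smooth functions `f₁, f₂` on
`G`, where `(f₁ ∪ f₂)(g₁, g₂) = f₁(g₁) f₂(g₂)`, `(θ ∪ f)(g₁, g₂) = f(g₂) θ(g₁)` and
`(f ∪ θ)(g₁, g₂) = f(g₁) (g₁ · θ(g₂))`. -/
def DerivationOnFunctions (C : EhresmannConnection EG EX S.tgt)
    (C₂ : EhresmannConnection E₂ EX S.tgt₂) : Prop :=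
  ∀ f₁ f₂ : G → ℝ, ContMDiff 𝓘(ℝ, EG) 𝓘(ℝ, ℝ) ∞ f₁ → ContMDiff 𝓘(ℝ, EG) 𝓘(ℝ, ℝ) ∞ f₂ →
    ∀ a : S.Composable,
      C₂.d (zeroCochain S.tgt₂ fun b => f₁ (S.pr₁ b) * f₂ (S.pr₂ b)) a =
        f₂ (S.pr₂ a) • C.d (zeroCochain S.tgt f₁) (S.pr₁ a) +
          f₁ (S.pr₁ a) • A.shift (C.d (zeroCochain S.tgt f₂)) a

end Differentials

section Multiplicative

variable [ChartedSpace E₂ S.Composable]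

variable (E₂) in
/-- `C` is closed under the product of the tangent groupoid: for `v ∈ C_{g₁}`, `w ∈ C_{g₂}` with
`(v, w)` tangent to the space of composable pairs, `dm(v, w) ∈ C_{g₁ g₂}`. -/
def ClosedUnderProduct (C : ∀ g : G, Submodule ℝ (TangentSpace 𝓘(ℝ, EG) g)) : Prop :=
  ∀ (a : S.Composable) (ξ : TangentSpace 𝓘(ℝ, E₂) a),
    mfderiv 𝓘(ℝ, E₂) 𝓘(ℝ, EG) S.pr₁ a ξ ∈ C (S.pr₁ a) →
    mfderiv 𝓘(ℝ, E₂) 𝓘(ℝ, EG) S.pr₂ a ξ ∈ C (S.pr₂ a) →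
    mfderiv 𝓘(ℝ, E₂) 𝓘(ℝ, EG) S.mul a ξ ∈ C (S.mul a)

variable (EX E₂) in
/-- `C ⊆ TG` is multiplicative: it is a subgroupoid of the tangent groupoid `TG ⇉ TX`,
with all of `TX` as space of objects. -/
structure IsMultiplicative (C : ∀ g : G, Submodule ℝ (TangentSpace 𝓘(ℝ, EG) g)) : Prop where
  src_surj : ∀ g, (C g).map (mfderiv 𝓘(ℝ, EG) 𝓘(ℝ, EX) S.src g).toLinearMap = ⊤
  tgt_surj : ∀ g, (C g).map (mfderiv 𝓘(ℝ, EG) 𝓘(ℝ, EX) S.tgt g).toLinearMap = ⊤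
  mul_mem : S.ClosedUnderProduct E₂ C
  unit_mem : ∀ (x : X) (v : TangentSpace 𝓘(ℝ, EX) x),
    mfderiv 𝓘(ℝ, EX) 𝓘(ℝ, EG) S.unit x v ∈ C (S.unit x)
  inv_mem : ∀ (g : G), ∀ v ∈ C g, mfderiv 𝓘(ℝ, EG) 𝓘(ℝ, EG) S.inv g v ∈ C (S.inv g)

end Multiplicative

end GroupoidOn

end

/-! Write `hor` and `hor₂` for the horizontal lifts of `C` and `C₂`. Everything rests on the
components of `hor₂` in `G × G`. Putting one function equal to 1 in the derivation identity, and
using that smooth functions separate tangent vectors, gives `dpr₁ (hor₂ v) = hor v` and `dpr₂ (hor₂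
v) = hor (g₁^* v)`. A vector tangent to the composable pairs is determined by its two components,
and a horizontal second component is determined by its image under `dt`, which equals `ds` of the
first component. Hence `C₂` consists of the vectors whose components both lie in `C`, and closure of
`C` under products says exactly that `dm (hor₂ v) = hor v`.

Next, evaluate the exterior derivative of the horizontal form of `δc` on lifts `hor₂ v`. The terms
`c(g₁g₂)` and `c(g₁)` are pullbacks along `m` and `pr₁`, so `d` passes through. The term `g₁ ·
c(g₂)` is not a pullback from `G`. At a fixed pair choose a form `α` on `X` with `α = c(g₂)` at
`t(g₂)` and split `c = c' + t^*α`. The contribution of `α` is pulled back along `pr₁` from `g · α(s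
g)`, where compatibility of the action applies. The contribution of `c'` vanishes at the point, so
only the derivative of `c'` along `hor (g₁^* v)` survives. Together (`formDeriv_shift`,
`formDeriv_δ₁`), `d(δc)` and `δ(dc)` differ only in evaluating `d` of the form of `c` at `g₁g₂` on
`dm (hor₂ v)` or on `hor v`. Equality of these vectors is therefore sufficient in all degrees, and
necessary already in degree 0.

Finally, closure under products gives the rest of multiplicativity. Over a pair of units the lift is
`(w, w)` with product `w`, and such idempotents are units. The inverses follow by cancelling a left
factor, and surjectivity of `ds` follows from `ds ∘ dτ = dt`. -/

noncomputable section

/-! ### Exterior derivative on manifolds: linearity, functions, naturality under pullback. -/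

section FormCalculus

variable {EP : Type*} [NormedAddCommGroup EP] [NormedSpace ℝ EP]
  {P : Type*} [TopologicalSpace P] [ChartedSpace EP P]
  {EQ : Type*} [NormedAddCommGroup EQ] [NormedSpace ℝ EQ]
  {Q : Type*} [TopologicalSpace Q] [ChartedSpace EQ Q]
  {ER : Type*} [NormedAddCommGroup ER] [NormedSpace ℝ ER]
  {R : Type*} [TopologicalSpace R] [ChartedSpace ER R]
  {q : ℕ}

variable (EP EQ) in
/-- The differential of a map of manifolds, as a map between the model spaces. -/
def modelDeriv (f : P → Q) (p : P) : EP →L[ℝ] EQ := mfderiv 𝓘(ℝ, EP) 𝓘(ℝ, EQ) f p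

theorem modelDeriv_comp {g : Q → R} {f : P → Q} (p : P)
    (hg : MDifferentiableAt 𝓘(ℝ, EQ) 𝓘(ℝ, ER) g (f p))
    (hf : MDifferentiableAt 𝓘(ℝ, EP) 𝓘(ℝ, EQ) f p) :
    modelDeriv EP ER (g ∘ f) p = modelDeriv EQ ER g (f p) ∘L modelDeriv EP EQ f p :=
  mfderiv_comp p hg hf

theorem modelDeriv_comp_apply {g : Q → R} {f : P → Q} (p : P)
    (hg : MDifferentiableAt 𝓘(ℝ, EQ) 𝓘(ℝ, ER) g (f p))
    (hf : MDifferentiableAt 𝓘(ℝ, EP) 𝓘(ℝ, EQ) f p) (v : EP) :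
    modelDeriv EP ER (g ∘ f) p v = modelDeriv EQ ER g (f p) (modelDeriv EP EQ f p v) := by
  rw [modelDeriv_comp p hg hf]; rfl

theorem modelDeriv_id (p : P) : modelDeriv EP EP (id : P → P) p = ContinuousLinearMap.id ℝ EP :=
  mfderiv_id

theorem modelDeriv_eq_fderiv (f : EP → EQ) (p : EP) : modelDeriv EP EQ f p = fderiv ℝ f p :=
  mfderiv_eq_fderiv

theorem modelDeriv_eq_fderiv_writtenInExtChartAt {f : P → Q} {p : P}
    (hf : MDifferentiableAt 𝓘(ℝ, EP) 𝓘(ℝ, EQ) f p) :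
    modelDeriv EP EQ f p =
      fderiv ℝ (writtenInExtChartAt 𝓘(ℝ, EP) 𝓘(ℝ, EQ) p f) (extChartAt 𝓘(ℝ, EP) p p) := by
  have := hf.mfderiv
  rw [modelDeriv, this, ModelWithCorners.range_eq_univ, fderivWithin_univ]

theorem Filter.EventuallyEq.modelDeriv_eq {f g : P → Q} {p : P} (h : f =ᶠ[𝓝 p] g) :
    modelDeriv EP EQ f p = modelDeriv EP EQ g p :=
  h.mfderiv_eq

/-- A differential form read in the preferred chart around `p`. -/
def chartForm (η : P → EP [⋀^Fin q]→L[ℝ] ℝ) (p : P) (y : EP) : EP [⋀^Fin q]→L[ℝ] ℝ :=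
  (η ((extChartAt 𝓘(ℝ, EP) p).symm y)).compContinuousLinearMap
    (modelDeriv EP EP (extChartAt 𝓘(ℝ, EP) p).symm y)

/-- A differential form is differentiable at `p` if it is so in the preferred chart around `p`. -/
def FormDifferentiableAt (η : P → EP [⋀^Fin q]→L[ℝ] ℝ) (p : P) : Prop :=
  DifferentiableAt ℝ (chartForm η p) (extChartAt 𝓘(ℝ, EP) p p)

/-- The exterior derivative of a form at `p`, computed in the preferred chart around `p`. -/
def formDeriv (η : P → EP [⋀^Fin q]→L[ℝ] ℝ) (p : P) : EP [⋀^Fin (q + 1)]→L[ℝ] ℝ :=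
  extDeriv (chartForm η p) (extChartAt 𝓘(ℝ, EP) p p)

theorem mExtDeriv_eq_formDeriv [IsManifold 𝓘(ℝ, EP) ∞ P] (η : P → EP [⋀^Fin q]→L[ℝ] ℝ) (p : P) :
    mExtDeriv η p = formDeriv η p := by
  unfold mExtDeriv
  -- The derivative of the preferred chart at its own centre is the identity of the model space, so
  -- the final transport disappears.
  rw [mfderiv_extChartAt_self]
  rfl

theorem FormDifferentiableAt.add {η η' : P → EP [⋀^Fin q]→L[ℝ] ℝ} {p : P}
    (h : FormDifferentiableAt η p) (h' : FormDifferentiableAt η' p) :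
    FormDifferentiableAt (fun z => η z + η' z) p :=
  DifferentiableAt.add h h'

theorem FormDifferentiableAt.sub {η η' : P → EP [⋀^Fin q]→L[ℝ] ℝ} {p : P}
    (h : FormDifferentiableAt η p) (h' : FormDifferentiableAt η' p) :
    FormDifferentiableAt (fun z => η z - η' z) p :=
  DifferentiableAt.sub h h'

theorem formDeriv_add {η η' : P → EP [⋀^Fin q]→L[ℝ] ℝ} {p : P}
    (h : FormDifferentiableAt η p) (h' : FormDifferentiableAt η' p) :
    formDeriv (fun z => η z + η' z) p = formDeriv η p + formDeriv η' p :=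
  extDeriv_add h h'

theorem formDeriv_sub {η η' : P → EP [⋀^Fin q]→L[ℝ] ℝ} {p : P}
    (h : FormDifferentiableAt η p) (h' : FormDifferentiableAt η' p) :
    formDeriv (fun z => η z - η' z) p = formDeriv η p - formDeriv η' p := by
  have := formDeriv_add (h.sub h') h'
  simp only [sub_add_cancel] at this
  exact eq_sub_of_add_eq this.symm

/-- The exterior derivative of a function is its differential. -/
theorem formDeriv_constOfIsEmpty (f : P → ℝ) (p : P) (v : Fin 1 → EP)
    (hf : MDifferentiableAt 𝓘(ℝ, EP) 𝓘(ℝ, ℝ) f p) :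
    formDeriv (fun z => ContinuousAlternatingMap.constOfIsEmpty ℝ EP (Fin 0) (f z)) p v =
      modelDeriv EP ℝ f p (v 0) := by
  have : chartForm (fun z => ContinuousAlternatingMap.constOfIsEmpty ℝ EP (Fin 0) (f z)) p =
      fun y => ContinuousAlternatingMap.constOfIsEmpty ℝ EP (Fin 0)
        (f ((extChartAt 𝓘(ℝ, EP) p).symm y)) := by
    ext y; simp [chartForm]
  rw [formDeriv, this, extDeriv_constOfIsEmpty, modelDeriv_eq_fderiv_writtenInExtChartAt hf]
  rfl

theorem contDiffAt_writtenInExtChartAt {f : P → Q} (hf : ContMDiff 𝓘(ℝ, EP) 𝓘(ℝ, EQ) ∞ f) (p : P) :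
    ContDiffAt ℝ ∞ (writtenInExtChartAt 𝓘(ℝ, EP) 𝓘(ℝ, EQ) p f) (extChartAt 𝓘(ℝ, EP) p p) := by
  have := (contMDiffAt_iff.1 (hf p)).2
  rwa [ModelWithCorners.range_eq_univ, contDiffWithinAt_univ] at this

theorem differentiableAt_comp_extChartAt_symm {F : Type*} [NormedAddCommGroup F] [NormedSpace ℝ F]
    {f : P → F} {p : P} (hf : MDifferentiableAt 𝓘(ℝ, EP) 𝓘(ℝ, F) f p) :
    DifferentiableAt ℝ (fun y => f ((extChartAt 𝓘(ℝ, EP) p).symm y))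
      (extChartAt 𝓘(ℝ, EP) p p) := by
  have := hf.differentiableWithinAt_writtenInExtChartAt
  rwa [ModelWithCorners.range_eq_univ, differentiableWithinAt_univ] at this

variable [IsManifold 𝓘(ℝ, EP) ∞ P] [IsManifold 𝓘(ℝ, EQ) ∞ Q]

theorem mdifferentiableAt_extChartAt_symm {p : P} {y : EP} (hy : y ∈ (extChartAt 𝓘(ℝ, EP) p).target) :
    MDifferentiableAt 𝓘(ℝ, EP) 𝓘(ℝ, EP) (extChartAt 𝓘(ℝ, EP) p).symm y := by
  have := mdifferentiableWithinAt_extChartAt_symm hy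
  rwa [ModelWithCorners.range_eq_univ, mdifferentiableWithinAt_univ] at this

/-- Differentiating `f ∘ φ⁻¹ = ψ⁻¹ ∘ F`, where `F` is `f` read in the charts `φ`, `ψ`, moves the
pullback into the model spaces, where `extDeriv_pullback` applies. The identity is only local
because `f` must land in the chart domain of `f p`. -/
theorem chartForm_pullback {f : P → Q} (hf : ContMDiff 𝓘(ℝ, EP) 𝓘(ℝ, EQ) ∞ f)
    (η : Q → EQ [⋀^Fin q]→L[ℝ] ℝ) (p : P) :
    chartForm (fun z => (η (f z)).compContinuousLinearMap (modelDeriv EP EQ f z)) p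
      =ᶠ[𝓝 (extChartAt 𝓘(ℝ, EP) p p)]
    fun y => (chartForm η (f p) (writtenInExtChartAt 𝓘(ℝ, EP) 𝓘(ℝ, EQ) p f y)).compContinuousLinearMap
      (fderiv ℝ (writtenInExtChartAt 𝓘(ℝ, EP) 𝓘(ℝ, EQ) p f) y) := by
  have hc := continuousAt_extChartAt_symm (I := 𝓘(ℝ, EP)) p
  have hfc : ContinuousAt (f ∘ (extChartAt 𝓘(ℝ, EP) p).symm) (extChartAt 𝓘(ℝ, EP) p p) :=
    hf.continuous.continuousAt.comp hc
  have h1 : ∀ᶠ y in 𝓝 (extChartAt 𝓘(ℝ, EP) p p),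
      f ((extChartAt 𝓘(ℝ, EP) p).symm y) ∈ (extChartAt 𝓘(ℝ, EQ) (f p)).source := by
    refine hfc.eventually_mem ?_
    simp only [Function.comp_apply, extChartAt_to_inv]
    exact extChartAt_source_mem_nhds (f p)
  -- Comparing derivatives at `y` requires the factorisation on a neighbourhood of `y`, not just at
  -- `y`.
  filter_upwards [h1.eventually_nhds, extChartAt_target_mem_nhds (I := 𝓘(ℝ, EP)) p] with y hy hyt
  set F := writtenInExtChartAt 𝓘(ℝ, EP) 𝓘(ℝ, EQ) p f with hF
  have hy0 := hy.self_of_nhds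
  have e1 : f ∘ (extChartAt 𝓘(ℝ, EP) p).symm =ᶠ[𝓝 y] (extChartAt 𝓘(ℝ, EQ) (f p)).symm ∘ F := by
    filter_upwards [hy] with z hz
    simp only [hF, writtenInExtChartAt, Function.comp_apply]
    rw [(extChartAt 𝓘(ℝ, EQ) (f p)).left_inv hz]
  have e2 : (extChartAt 𝓘(ℝ, EQ) (f p)).symm (F y) = f ((extChartAt 𝓘(ℝ, EP) p).symm y) :=
    e1.symm.self_of_nhds
  have hsymm := mdifferentiableAt_extChartAt_symm hyt
  have hfd : MDifferentiableAt 𝓘(ℝ, EP) 𝓘(ℝ, EQ) f ((extChartAt 𝓘(ℝ, EP) p).symm y) :=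
    (hf _).mdifferentiableAt (by simp)
  have hFy : F y ∈ (extChartAt 𝓘(ℝ, EQ) (f p)).target :=
    (extChartAt 𝓘(ℝ, EQ) (f p)).map_source hy0
  have hFd : MDifferentiableAt 𝓘(ℝ, EP) 𝓘(ℝ, EQ) F y := by
    refine MDifferentiableAt.comp y (mdifferentiableAt_extChartAt (I := 𝓘(ℝ, EQ)) ?_)
      (hfd.comp y hsymm)
    simpa using hy0
  have key := e1.modelDeriv_eq (EP := EP) (EQ := EQ)
  rw [modelDeriv_comp y hfd hsymm, modelDeriv_comp y (mdifferentiableAt_extChartAt_symm hFy) hFd,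
    modelDeriv_eq_fderiv F] at key
  simp only [chartForm]
  rw [e2]
  ext v
  exact congrArg (η (f ((extChartAt 𝓘(ℝ, EP) p).symm y)))
    (funext fun i => congrArg (fun T : EP →L[ℝ] EQ => T (v i)) key)

theorem FormDifferentiableAt.pullback {f : P → Q} (hf : ContMDiff 𝓘(ℝ, EP) 𝓘(ℝ, EQ) ∞ f)
    {η : Q → EQ [⋀^Fin q]→L[ℝ] ℝ} {p : P} (hη : FormDifferentiableAt η (f p)) :
    FormDifferentiableAt
      (fun z => (η (f z)).compContinuousLinearMap (modelDeriv EP EQ f z)) p := by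
  have hF := contDiffAt_writtenInExtChartAt hf p
  have hp : writtenInExtChartAt 𝓘(ℝ, EP) 𝓘(ℝ, EQ) p f (extChartAt 𝓘(ℝ, EP) p p) =
    extChartAt 𝓘(ℝ, EQ) (f p) (f p) := by simp [writtenInExtChartAt]
  have h1 : DifferentiableAt ℝ (fun y => chartForm η (f p)
      (writtenInExtChartAt 𝓘(ℝ, EP) 𝓘(ℝ, EQ) p f y)) (extChartAt 𝓘(ℝ, EP) p p) := by
    have h0 : DifferentiableAt ℝ (chartForm η (f p))
        (writtenInExtChartAt 𝓘(ℝ, EP) 𝓘(ℝ, EQ) p f (extChartAt 𝓘(ℝ, EP) p p)) := by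
      rw [hp]; exact hη
    exact h0.comp _ (hF.differentiableAt (by simp))
  have h2 : DifferentiableAt ℝ (fderiv ℝ (writtenInExtChartAt 𝓘(ℝ, EP) 𝓘(ℝ, EQ) p f))
      (extChartAt 𝓘(ℝ, EP) p p) :=
    (hF.fderiv_right (m := 1) (by norm_cast)).differentiableAt (by simp)
  exact (h1.continuousAlternatingMapCompContinuousLinearMap h2).congr_of_eventuallyEq
    (chartForm_pullback hf η p)

/-- The exterior derivative commutes with pullback along smooth maps. -/
theorem formDeriv_pullback {f : P → Q} (hf : ContMDiff 𝓘(ℝ, EP) 𝓘(ℝ, EQ) ∞ f)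
    {η : Q → EQ [⋀^Fin q]→L[ℝ] ℝ} {p : P} (hη : FormDifferentiableAt η (f p)) :
    formDeriv (fun z => (η (f z)).compContinuousLinearMap (modelDeriv EP EQ f z)) p =
      (formDeriv η (f p)).compContinuousLinearMap (modelDeriv EP EQ f p) := by
  have hF := contDiffAt_writtenInExtChartAt hf p
  have hp : writtenInExtChartAt 𝓘(ℝ, EP) 𝓘(ℝ, EQ) p f (extChartAt 𝓘(ℝ, EP) p p) =
    extChartAt 𝓘(ℝ, EQ) (f p) (f p) := by simp [writtenInExtChartAt]
  rw [formDeriv, (chartForm_pullback hf η p).extDeriv_eq,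
    extDeriv_pullback (r := ∞) (by rw [hp]; exact hη) hF (by simp; norm_cast), hp, formDeriv,
    modelDeriv_eq_fderiv_writtenInExtChartAt ((hf p).mdifferentiableAt (by simp))]

end FormCalculus

/-! ### Forms `c(B -, …, B -)` built from a cochain and a bundle map, in local frames. -/

section Cochains

variable {EP : Type*} [NormedAddCommGroup EP] [NormedSpace ℝ EP]
  {P : Type*} [TopologicalSpace P] [ChartedSpace EP P] [IsManifold 𝓘(ℝ, EP) ∞ P]
  {EX : Type*} [NormedAddCommGroup EX] [NormedSpace ℝ EX]
  {X : Type*} [TopologicalSpace X] [ChartedSpace EX X] [IsManifold 𝓘(ℝ, EX) ∞ X]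
  {q : ℕ}

/-- A section `c` of `σ^* Λ^q T^*X`, written in the frame given by the chart of `X` at `σ p₀`. -/
def cochainCoord (σ : P → X) (c : P → EX [⋀^Fin q]→L[ℝ] ℝ) (p₀ p : P) : EX [⋀^Fin q]→L[ℝ] ℝ :=
  (c p).compContinuousLinearMap (tangentCoordChange 𝓘(ℝ, EX) (σ p₀) (σ p) (σ p))

variable (EP) in
/-- A bundle map `B : TP → σ^* TX`, written in the charts at `p₀` and `σ p₀`. -/
def bundleMapCoord (σ : P → X) (B : P → EP →L[ℝ] EX) (p₀ p : P) : EP →L[ℝ] EX :=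
  inTangentCoordinates 𝓘(ℝ, EP) 𝓘(ℝ, EX) id σ B p₀ p

theorem tangentCoordChange_eq_modelDeriv_symm {p₀ : P} {y : EP}
    (hy : y ∈ (extChartAt 𝓘(ℝ, EP) p₀).target) :
    tangentCoordChange 𝓘(ℝ, EP) p₀ ((extChartAt 𝓘(ℝ, EP) p₀).symm y)
      ((extChartAt 𝓘(ℝ, EP) p₀).symm y) = modelDeriv EP EP (extChartAt 𝓘(ℝ, EP) p₀).symm y := by
  rw [modelDeriv_eq_fderiv_writtenInExtChartAt (mdifferentiableAt_extChartAt_symm hy),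
    tangentCoordChange_def, (extChartAt 𝓘(ℝ, EP) p₀).right_inv hy, ModelWithCorners.range_eq_univ,
    fderivWithin_univ]
  rfl

theorem tangentCoordChange_self_eq_id (x : X) :
    tangentCoordChange 𝓘(ℝ, EX) x x x = ContinuousLinearMap.id ℝ EX := by
  ext v
  exact tangentCoordChange_self (mem_extChartAt_source x)

theorem cochainCoord_self {Q : Type*} (σ : Q → X) (c : Q → EX [⋀^Fin q]→L[ℝ] ℝ) (p : Q) :
    cochainCoord σ c p p = c p := by
  ext v
  rw [cochainCoord, tangentCoordChange_self_eq_id]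
  rfl

theorem bundleMapCoord_self (σ : P → X) (B : P → EP →L[ℝ] EX) (p : P) :
    bundleMapCoord EP σ B p p = B p := by
  rw [bundleMapCoord, inTangentCoordinates_eq _ _ _ (mem_chart_source _ _) (mem_chart_source _ _)]
  have h1 := tangentCoordChange_self_eq_id (EX := EX) (σ p)
  have h2 := tangentCoordChange_self_eq_id (EX := EP) p
  simp only [tangentCoordChange] at h1 h2
  rw [h1, id, h2]
  rfl

/-- The frame change at `σ p` enters `c` and `B` with opposite directions and cancels.
Differentiability of the form can thus be checked on the two factors separately. -/
theorem cochainCoord_comp_bundleMapCoord {σ : P → X} (c : P → EX [⋀^Fin q]→L[ℝ] ℝ)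
    (B : P → EP →L[ℝ] EX) {p₀ : P} {y : EP} (hy : y ∈ (extChartAt 𝓘(ℝ, EP) p₀).target)
    (hσ : σ ((extChartAt 𝓘(ℝ, EP) p₀).symm y) ∈ (chartAt EX (σ p₀)).source) :
    chartForm (fun p => (c p).compContinuousLinearMap (B p)) p₀ y =
      (cochainCoord σ c p₀ ((extChartAt 𝓘(ℝ, EP) p₀).symm y)).compContinuousLinearMap
        (bundleMapCoord EP σ B p₀ ((extChartAt 𝓘(ℝ, EP) p₀).symm y)) := by
  set p := (extChartAt 𝓘(ℝ, EP) p₀).symm y with hp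
  have hps : p ∈ (chartAt EP p₀).source := by
    rw [← extChartAt_source 𝓘(ℝ, EP)]
    exact (extChartAt 𝓘(ℝ, EP) p₀).map_target hy
  have hB : bundleMapCoord EP σ B p₀ p =
      tangentCoordChange 𝓘(ℝ, EX) (σ p) (σ p₀) (σ p) ∘L B p ∘L
        modelDeriv EP EP (extChartAt 𝓘(ℝ, EP) p₀).symm y := by
    rw [← tangentCoordChange_eq_modelDeriv_symm hy]
    exact inTangentCoordinates_eq _ _ _ hps hσ
  have hinv (w : EX) : tangentCoordChange 𝓘(ℝ, EX) (σ p₀) (σ p) (σ p)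
      (tangentCoordChange 𝓘(ℝ, EX) (σ p) (σ p₀) (σ p) w) = w := by
    have hs : σ p ∈ (extChartAt 𝓘(ℝ, EX) (σ p₀)).source := by simpa using hσ
    rw [tangentCoordChange_comp ⟨⟨mem_extChartAt_source _, hs⟩, mem_extChartAt_source _⟩,
      tangentCoordChange_self (mem_extChartAt_source _)]
  rw [hB]
  ext v
  refine congrArg (c p) (funext fun i => ?_)
  exact (hinv _).symm

theorem chartForm_comp_eventuallyEq {σ : P → X} (c : P → EX [⋀^Fin q]→L[ℝ] ℝ)
    (B : P → EP →L[ℝ] EX) {p₀ : P} (hσ : ContinuousAt σ p₀) :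
    chartForm (fun p => (c p).compContinuousLinearMap (B p)) p₀
      =ᶠ[𝓝 (extChartAt 𝓘(ℝ, EP) p₀ p₀)] fun y =>
      (cochainCoord σ c p₀ ((extChartAt 𝓘(ℝ, EP) p₀).symm y)).compContinuousLinearMap
        (bundleMapCoord EP σ B p₀ ((extChartAt 𝓘(ℝ, EP) p₀).symm y)) := by
  have hc := continuousAt_extChartAt_symm (I := 𝓘(ℝ, EP)) p₀
  have h1 : ∀ᶠ z in 𝓝 ((extChartAt 𝓘(ℝ, EP) p₀).symm (extChartAt 𝓘(ℝ, EP) p₀ p₀)),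
      σ z ∈ (chartAt EX (σ p₀)).source := by
    rw [extChartAt_to_inv]
    exact hσ.eventually_mem (chart_source_mem_nhds EX (σ p₀))
  filter_upwards [hc.eventually h1, extChartAt_target_mem_nhds (I := 𝓘(ℝ, EP)) p₀] with y hy hyt
  exact cochainCoord_comp_bundleMapCoord c B hyt hy

/-- The form `c(B -, …, B -)` is differentiable if `c` and `B` are. -/
theorem formDifferentiableAt_comp {σ : P → X} {c : P → EX [⋀^Fin q]→L[ℝ] ℝ}
    {B : P → EP →L[ℝ] EX} {p₀ : P} (hσ : ContinuousAt σ p₀)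
    (hc : MDifferentiableAt 𝓘(ℝ, EP) 𝓘(ℝ, EX [⋀^Fin q]→L[ℝ] ℝ) (cochainCoord σ c p₀) p₀)
    (hB : MDifferentiableAt 𝓘(ℝ, EP) 𝓘(ℝ, EP →L[ℝ] EX) (bundleMapCoord EP σ B p₀) p₀) :
    FormDifferentiableAt (fun p => (c p).compContinuousLinearMap (B p)) p₀ :=
  ((differentiableAt_comp_extChartAt_symm hc).continuousAlternatingMapCompContinuousLinearMap
    (differentiableAt_comp_extChartAt_symm hB)).congr_of_eventuallyEq
      (chartForm_comp_eventuallyEq c B hσ)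

/-- The exterior derivative of `c(B -, …, B -)` at a zero of `c` only involves the derivative
of `c`. -/
theorem formDeriv_comp_of_eq_zero {σ : P → X} {c : P → EX [⋀^Fin q]→L[ℝ] ℝ}
    {B : P → EP →L[ℝ] EX} {p₀ : P} (hσ : ContinuousAt σ p₀)
    (hc : MDifferentiableAt 𝓘(ℝ, EP) 𝓘(ℝ, EX [⋀^Fin q]→L[ℝ] ℝ) (cochainCoord σ c p₀) p₀)
    (hB : MDifferentiableAt 𝓘(ℝ, EP) 𝓘(ℝ, EP →L[ℝ] EX) (bundleMapCoord EP σ B p₀) p₀)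
    (h0 : c p₀ = 0) (v : Fin (q + 1) → EP) :
    formDeriv (fun p => (c p).compContinuousLinearMap (B p)) p₀ v =
      ∑ i, (-1) ^ i.val • (modelDeriv EP (EX [⋀^Fin q]→L[ℝ] ℝ) (cochainCoord σ c p₀) p₀ (v i))
        (fun j => B p₀ (i.removeNth v j)) := by
  have hd : modelDeriv EP (EX [⋀^Fin q]→L[ℝ] ℝ) (cochainCoord σ c p₀) p₀ =
      fderiv ℝ (fun y => cochainCoord σ c p₀ ((extChartAt 𝓘(ℝ, EP) p₀).symm y))
        (extChartAt 𝓘(ℝ, EP) p₀ p₀) := modelDeriv_eq_fderiv_writtenInExtChartAt hc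
  rw [formDeriv, (chartForm_comp_eventuallyEq c B hσ).extDeriv_eq, extDeriv,
    fderiv_continuousAlternatingMapCompContinuousLinearMap
      (differentiableAt_comp_extChartAt_symm hc) (differentiableAt_comp_extChartAt_symm hB), hd,
    ContinuousAlternatingMap.alternatizeUncurryFin_apply]
  refine Finset.sum_congr rfl fun i _ => ?_
  congr 1
  -- The product-rule terms that differentiate `B` carry the factor `c p₀ = 0`.
  simp only [extChartAt_to_inv, cochainCoord_self, h0, bundleMapCoord_self]
  simp [ContinuousAlternatingMap.fderivCompContinuousLinearMap_apply, Function.comp_def]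

theorem mdifferentiableAt_bundleMapCoord_modelDeriv {f : P → X}
    (hf : ContMDiff 𝓘(ℝ, EP) 𝓘(ℝ, EX) ∞ f) (p : P) :
    MDifferentiableAt 𝓘(ℝ, EP) 𝓘(ℝ, EP →L[ℝ] EX)
      (bundleMapCoord EP f (modelDeriv EP EX f) p) p :=
  ((hf p).mfderiv_const (m := 1) (by norm_cast)).mdifferentiableAt (by simp)

end Cochains

/-! ### Test functions and test forms on `X` and `G`. -/

section TestForms

variable {EX : Type*} [NormedAddCommGroup EX] [NormedSpace ℝ EX] [FiniteDimensional ℝ EX] {q : ℕ}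

/-- The pullback of a fixed alternating map depends smoothly on the linear map. -/
theorem contDiff_compContinuousLinearMap (c : EX [⋀^Fin q]→L[ℝ] ℝ) :
    ContDiff ℝ ∞ fun T : EX →L[ℝ] EX => c.compContinuousLinearMap T := by
  -- Among multilinear maps, pullback is a continuous multilinear expression in the linear maps,
  -- hence smooth on the diagonal. A linear retraction onto alternating maps, continuous by finite
  -- dimension, brings the result back.
  let M := ContinuousMultilinearMap ℝ (fun _ : Fin q => EX) ℝ
  have : FiniteDimensional ℝ M := Module.Finite.of_injective
    (ContinuousMultilinearMap.toMultilinearMapLinear (R' := ℝ) (A := ℝ) (M₁ := fun _ : Fin q => EX)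
      (M₂ := ℝ)) ContinuousMultilinearMap.toMultilinearMap_injective
  let ι : (EX [⋀^Fin q]→L[ℝ] ℝ) →ₗ[ℝ] M :=
    ContinuousAlternatingMap.toContinuousMultilinearMapLinear
  obtain ⟨ρ, hρ⟩ := LinearMap.exists_leftInverse_of_injective ι
    (LinearMap.ker_eq_bot.2 ContinuousAlternatingMap.toContinuousMultilinearMap_injective)
  let ρ' : M →L[ℝ] (EX [⋀^Fin q]→L[ℝ] ℝ) := LinearMap.toContinuousLinearMap ρ
  have h : (fun T : EX →L[ℝ] EX => c.compContinuousLinearMap T) = fun T =>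
      ρ' (ContinuousMultilinearMap.compContinuousLinearMapContinuousMultilinear ℝ
        (fun _ : Fin q => EX) (fun _ : Fin q => EX) ℝ (fun _ => T) c.toContinuousMultilinearMap) := by
    funext T
    exact (LinearMap.congr_fun hρ (c.compContinuousLinearMap T)).symm
  rw [h]
  refine ρ'.contDiff.comp (ContDiff.clm_apply ?_ contDiff_const)
  exact (ContinuousMultilinearMap.contDiff _).comp (contDiff_pi.2 fun _ => contDiff_id)

variable {X : Type*} [TopologicalSpace X] [T2Space X] [ChartedSpace EX X] [IsManifold 𝓘(ℝ, EX) ∞ X]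

/-- Tangent vectors are separated by the differentials of smooth functions. -/
theorem eq_of_forall_modelDeriv_eq {x : X} {v w : EX}
    (h : ∀ f : X → ℝ, ContMDiff 𝓘(ℝ, EX) 𝓘(ℝ, ℝ) ∞ f →
      modelDeriv EX ℝ f x v = modelDeriv EX ℝ f x w) : v = w := by
  refine (SeparatingDual.eq_iff_forall_dual_eq (R := ℝ)).2 fun ℓ => ?_
  obtain ⟨b⟩ : Nonempty (SmoothBumpFunction 𝓘(ℝ, EX) x) := inferInstance
  -- The test function is the functional `ℓ` read in the chart and cut off by a bump function; its
  -- differential at `x` is `ℓ`.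
  have hs : ContMDiffOn 𝓘(ℝ, EX) 𝓘(ℝ, ℝ) ∞ (ℓ ∘ extChartAt 𝓘(ℝ, EX) x) (chartAt EX x).source :=
    ℓ.contMDiff.comp_contMDiffOn contMDiffOn_extChartAt
  have hb := b.contMDiff_smul hs
  have he : (fun z => b z • (ℓ ∘ extChartAt 𝓘(ℝ, EX) x) z) =ᶠ[𝓝 x] ℓ ∘ extChartAt 𝓘(ℝ, EX) x := by
    filter_upwards [b.eventuallyEq_one] with z hz
    rw [hz]; simp
  have hd : modelDeriv EX ℝ (fun z => b z • (ℓ ∘ extChartAt 𝓘(ℝ, EX) x) z) x = ℓ := by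
    rw [he.modelDeriv_eq, modelDeriv_comp x ℓ.mdifferentiableAt
      (mdifferentiableAt_extChartAt (mem_chart_source EX x)), modelDeriv_eq_fderiv, ℓ.fderiv]
    have : modelDeriv EX EX (extChartAt 𝓘(ℝ, EX) x) x = ContinuousLinearMap.id ℝ EX :=
      mfderiv_extChartAt_self
    rw [this, ContinuousLinearMap.comp_id]
  have := h _ hb
  rwa [hd] at this

/-- Every alternating form on a tangent space extends to a smooth differential form. -/
theorem exists_isSmoothCochain_eq (x₀ : X) (c : EX [⋀^Fin q]→L[ℝ] ℝ) :
    ∃ α : X → EX [⋀^Fin q]→L[ℝ] ℝ,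
      (∀ x, ContMDiffAt 𝓘(ℝ, EX) 𝓘(ℝ, EX [⋀^Fin q]→L[ℝ] ℝ) ∞ (cochainCoord (fun x => x) α x) x) ∧
        α x₀ = c := by
  obtain ⟨b⟩ : Nonempty (SmoothBumpFunction 𝓘(ℝ, EX) x₀) := inferInstance
  -- The form has constant coefficients `c` in the chart at `x₀`, cut off inside that chart.
  refine ⟨fun x => b x • c.compContinuousLinearMap (tangentCoordChange 𝓘(ℝ, EX) x x₀ x),
    fun x => ?_, ?_⟩
  · by_cases hx : x ∈ (chartAt EX x₀).source
    · have h1 : ContMDiffAt 𝓘(ℝ, EX) 𝓘(ℝ, EX →L[ℝ] EX) ∞ (tangentCoordChange 𝓘(ℝ, EX) x x₀) x := by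
        have : (tangentBundleCore 𝓘(ℝ, EX) X).IsContMDiff 𝓘(ℝ, EX) ∞ :=
          tangentBundleCore.isContMDiff (h := inferInstanceAs (IsManifold 𝓘(ℝ, EX) ∞ X))
        refine ((tangentBundleCore 𝓘(ℝ, EX) X).contMDiffOn_coordChange 𝓘(ℝ, EX) (n := ∞)
          (achart EX x) (achart EX x₀)).contMDiffAt ?_
        exact ((chartAt EX x).open_source.inter (chartAt EX x₀).open_source).mem_nhds
          ⟨mem_chart_source EX x, hx⟩
      have h2 : ContMDiffAt 𝓘(ℝ, EX) 𝓘(ℝ, EX [⋀^Fin q]→L[ℝ] ℝ) ∞ (fun z =>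
          b z • c.compContinuousLinearMap (tangentCoordChange 𝓘(ℝ, EX) x x₀ z)) x :=
        b.contMDiffAt.smul ((contDiff_compContinuousLinearMap c).contMDiff.contMDiffAt.comp x h1)
      refine h2.congr_of_eventuallyEq ?_
      filter_upwards [chart_source_mem_nhds EX x, (chartAt EX x₀).open_source.mem_nhds hx]
        with z hz hz0
      ext v
      refine congrArg (fun r => b z * r) (congrArg c (funext fun i => ?_))
      refine tangentCoordChange_comp ⟨⟨?_, mem_extChartAt_source z⟩, ?_⟩ <;>
        simpa using ‹_›
    · have hz : (b : X → ℝ) =ᶠ[𝓝 x] 0 :=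
        notMem_tsupport_iff_eventuallyEq.1 fun h => hx (b.tsupport_subset_chartAt_source h)
      refine (contMDiffAt_const (c := (0 : EX [⋀^Fin q]→L[ℝ] ℝ))).congr_of_eventuallyEq ?_
      filter_upwards [hz] with z hz
      ext v
      simp [cochainCoord, hz]
  · simp only [b.eq_one, one_smul]
    rw [tangentCoordChange_self_eq_id]
    rfl

end TestForms

/-! ### Local inverses of immersions and submersions. -/

section LocalInverses

variable {E : Type*} [NormedAddCommGroup E] [NormedSpace ℝ E]
  {M : Type*} [TopologicalSpace M] [ChartedSpace E M]
  {E' : Type*} [NormedAddCommGroup E'] [NormedSpace ℝ E']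

/-- An immersion has a local left inverse. -/
theorem Manifold.IsImmersionAt.exists_leftInverse {H : Type*} [TopologicalSpace H]
    {J : ModelWithCorners ℝ E' H} {N : Type*} [TopologicalSpace N] [ChartedSpace H N]
    [IsManifold J ∞ N] {f : M → N} {x : M} (h : IsImmersionAt 𝓘(ℝ, E) J ∞ f x) :
    ∃ g : N → M, MDifferentiableAt J 𝓘(ℝ, E) g (f x) ∧ g ∘ f =ᶠ[𝓝 x] id := by
  have hd : h.domChart ∈ IsManifold.maximalAtlas 𝓘(ℝ, E) 1 M :=
    IsManifold.maximalAtlas_subset_of_le (by norm_cast) h.domChart_mem_maximalAtlas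
  have hc : h.codChart ∈ IsManifold.maximalAtlas J 1 N :=
    IsManifold.maximalAtlas_subset_of_le (by norm_cast) h.codChart_mem_maximalAtlas
  -- In adapted charts the immersion is `y ↦ (y, 0)`, so projecting to the first factor inverts it.
  let π : E' →L[ℝ] E := ContinuousLinearMap.fst ℝ _ _ ∘L h.equiv.symm.toContinuousLinearMap
  have key : ∀ z ∈ h.domChart.source, π (h.codChart.extend J (f z)) = h.domChart z := by
    intro z hz
    have hmem : h.domChart z ∈ (h.domChart.extend 𝓘(ℝ, E)).target := by
      simpa using h.domChart.map_source hz
    have := h.writtenInCharts hmem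
    have e : (h.codChart.extend J) (f z) = h.equiv (h.domChart z, 0) := by
      simpa [hz] using this
    rw [e]
    simp [π]
  refine ⟨h.domChart.symm ∘ π ∘ h.codChart.extend J, ?_, ?_⟩
  · have h1 : MDifferentiableAt J 𝓘(ℝ, E') (h.codChart.extend J) (f x) :=
      J.mdifferentiableAt.comp (f x) (mdifferentiableAt_of_mem_maximalAtlas hc h.mem_codChart_source)
    refine MDifferentiableAt.comp (f x) ?_ (π.mdifferentiableAt.comp (f x) h1)
    refine mdifferentiableAt_symm_of_mem_maximalAtlas hd ?_
    simp only [Function.comp_apply]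
    rw [key x h.mem_domChart_source]
    exact h.domChart.map_source h.mem_domChart_source
  · filter_upwards [h.domChart.open_source.mem_nhds h.mem_domChart_source] with z hz
    simp only [Function.comp_apply, id]
    rw [key z hz, h.domChart.left_inv hz]

/-- A submersion has a local section through every point. -/
theorem Manifold.IsSubmersionAt.exists_section {N : Type*} [TopologicalSpace N] [ChartedSpace E' N]
    [IsManifold 𝓘(ℝ, E') ∞ N] {f : M → N} {x : M}
    (h : IsSubmersionAt 𝓘(ℝ, E) 𝓘(ℝ, E') ∞ f x) :
    ∃ g : N → M, MDifferentiableAt 𝓘(ℝ, E') 𝓘(ℝ, E) g (f x) ∧ g (f x) = x ∧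
      f ∘ g =ᶠ[𝓝 (f x)] id := by
  have hd : h.domChart ∈ IsManifold.maximalAtlas 𝓘(ℝ, E) 1 M :=
    IsManifold.maximalAtlas_subset_of_le (by norm_cast) h.domChart_mem_maximalAtlas
  have hc : h.codChart ∈ IsManifold.maximalAtlas 𝓘(ℝ, E') 1 N :=
    IsManifold.maximalAtlas_subset_of_le (by norm_cast) h.codChart_mem_maximalAtlas
  have key : ∀ y ∈ h.domChart.target, h.codChart (f (h.domChart.symm y)) = (h.equiv y).1 := by
    intro y hy
    have hmem : y ∈ (h.domChart.extend 𝓘(ℝ, E)).target := by simpa using hy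
    simpa using h.writtenInCharts hmem
  have hx := h.mem_domChart_source
  -- In adapted charts the submersion is the first projection; the section freezes the complementary
  -- coordinate at its value at `x`.
  let κ : E' → E := fun y => h.equiv.symm (y, (h.equiv (h.domChart x)).2)
  have hκx : κ (h.codChart (f x)) = h.domChart x := by
    have := key _ (h.domChart.map_source hx)
    rw [h.domChart.left_inv hx] at this
    simp [κ, this]
  have hκ : Differentiable ℝ κ :=
    h.equiv.symm.differentiable.comp (differentiable_id.prodMk (differentiable_const _))
  have hcd : MDifferentiableAt 𝓘(ℝ, E') 𝓘(ℝ, E') h.codChart (f x) :=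
    mdifferentiableAt_of_mem_maximalAtlas hc h.mem_codChart_source
  have hκc : MDifferentiableAt 𝓘(ℝ, E') 𝓘(ℝ, E) (κ ∘ h.codChart) (f x) :=
    (hκ _).mdifferentiableAt.comp (f x) hcd
  have ht : κ (h.codChart (f x)) ∈ h.domChart.target := by
    rw [hκx]; exact h.domChart.map_source hx
  refine ⟨h.domChart.symm ∘ κ ∘ h.codChart, ?_, ?_, ?_⟩
  · exact (mdifferentiableAt_symm_of_mem_maximalAtlas hd ht).comp (f x) hκc
  · simp only [Function.comp_apply]
    rw [hκx, h.domChart.left_inv hx]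
  · filter_upwards [h.codChart.open_source.mem_nhds h.mem_codChart_source,
      hκc.continuousAt.eventually_mem (h.domChart.open_target.mem_nhds ht)] with y hy hyt
    have e := key _ hyt
    have hs : f (h.domChart.symm (κ (h.codChart y))) ∈ h.codChart.source :=
      h.source_subset_preimage_source (h.domChart.map_target hyt)
    refine h.codChart.injOn hs hy ?_
    refine e.trans ?_
    simp [κ]

/-- The differential of a submersion is surjective. -/
theorem Manifold.IsSubmersionAt.modelDeriv_surjective {N : Type*} [TopologicalSpace N]
    [ChartedSpace E' N] [IsManifold 𝓘(ℝ, E') ∞ N] {f : M → N} {x : M}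
    (h : IsSubmersionAt 𝓘(ℝ, E) 𝓘(ℝ, E') ∞ f x) :
    Function.Surjective (modelDeriv E E' f x) := by
  obtain ⟨g, hg, hgx, hfg⟩ := h.exists_section
  have hf : MDifferentiableAt 𝓘(ℝ, E) 𝓘(ℝ, E') f (g (f x)) := by
    rw [hgx]
    exact h.isSubmersionAtOfComplement_complement.contMDiffAt.mdifferentiableAt (by simp)
  have := hfg.modelDeriv_eq (EP := E') (EQ := E')
  rw [modelDeriv_comp _ hf hg, modelDeriv_id, hgx] at this
  intro v
  exact ⟨modelDeriv E' E g (f x) v, DFunLike.congr_fun this v⟩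

end LocalInverses

/-! ### The manifold of composable pairs. -/

namespace GroupoidOn

variable {X G : Type*} {S : GroupoidOn X G}
  {EX : Type*} [NormedAddCommGroup EX] [NormedSpace ℝ EX]
  [TopologicalSpace X] [ChartedSpace EX X]
  {EG : Type*} [NormedAddCommGroup EG] [NormedSpace ℝ EG]
  [TopologicalSpace G] [ChartedSpace EG G]
  {E₂ : Type*} [NormedAddCommGroup E₂] [NormedSpace ℝ E₂]
  [ChartedSpace E₂ S.Composable]

namespace IsLie

theorem contMDiff_src (hS : S.IsLie EX EG E₂) : ContMDiff 𝓘(ℝ, EG) 𝓘(ℝ, EX) ∞ S.src := fun g =>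
  (hS.src_submersion.isSubmersionAt g).isSubmersionAtOfComplement_complement.contMDiffAt

theorem contMDiff_tgt (hS : S.IsLie EX EG E₂) : ContMDiff 𝓘(ℝ, EG) 𝓘(ℝ, EX) ∞ S.tgt := fun g =>
  (hS.tgt_submersion.isSubmersionAt g).isSubmersionAtOfComplement_complement.contMDiffAt

theorem contMDiff_pr₁ (hS : S.IsLie EX EG E₂) : ContMDiff 𝓘(ℝ, E₂) 𝓘(ℝ, EG) ∞ S.pr₁ :=
  contMDiff_fst.comp hS.composable_embedded.contMDiff

theorem contMDiff_pr₂ (hS : S.IsLie EX EG E₂) : ContMDiff 𝓘(ℝ, E₂) 𝓘(ℝ, EG) ∞ S.pr₂ :=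
  contMDiff_snd.comp hS.composable_embedded.contMDiff

/-- A map into the space of composable pairs is smooth if its components are. -/
theorem contMDiff_of_comp [IsManifold 𝓘(ℝ, EG) ∞ G] [IsManifold 𝓘(ℝ, E₂) ∞ S.Composable]
    (hS : S.IsLie EX EG E₂) {EM M : Type*} [NormedAddCommGroup EM] [NormedSpace ℝ EM]
    [TopologicalSpace M] [ChartedSpace EM M] {F : M → S.Composable}
    (h₁ : ContMDiff 𝓘(ℝ, EM) 𝓘(ℝ, EG) ∞ (S.pr₁ ∘ F))
    (h₂ : ContMDiff 𝓘(ℝ, EM) 𝓘(ℝ, EG) ∞ (S.pr₂ ∘ F)) :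
    ContMDiff 𝓘(ℝ, EM) 𝓘(ℝ, E₂) ∞ F := by
  have h := h₁.prodMk h₂
  exact (ContMDiff.iff_comp_isImmersion hS.composable_embedded.isImmersion).2
    ⟨hS.composable_embedded.isEmbedding.continuous_iff.2 h.continuous, h⟩

/-- A tangent vector to the space of composable pairs is determined by its components. -/
theorem eq_zero_of_modelDeriv_pr [IsManifold 𝓘(ℝ, EG) ∞ G]
    [IsManifold 𝓘(ℝ, E₂) ∞ S.Composable] (hS : S.IsLie EX EG E₂)
   {a : S.Composable} {ξ : E₂} (h₁ : modelDeriv E₂ EG S.pr₁ a ξ = 0)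
    (h₂ : modelDeriv E₂ EG S.pr₂ a ξ = 0) : ξ = 0 := by
  obtain ⟨g, hg, hgf⟩ := (hS.composable_embedded.isImmersion.isImmersionAt a).exists_leftInverse
  have hd₁ : MDifferentiableAt 𝓘(ℝ, E₂) 𝓘(ℝ, EG) S.pr₁ a :=
    (hS.contMDiff_pr₁ a).mdifferentiableAt (by simp)
  have hd₂ : MDifferentiableAt 𝓘(ℝ, E₂) 𝓘(ℝ, EG) S.pr₂ a :=
    (hS.contMDiff_pr₂ a).mdifferentiableAt (by simp)
  have hv : mfderiv 𝓘(ℝ, E₂) (𝓘(ℝ, EG).prod 𝓘(ℝ, EG)) (Subtype.val : S.Composable → G × G) a ξ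
      = (0 : EG × EG) := by
    have := mfderiv_prodMk hd₁ hd₂
    exact (DFunLike.congr_fun this ξ).trans (Prod.ext h₁ h₂)
  have hval : MDifferentiableAt 𝓘(ℝ, E₂) (𝓘(ℝ, EG).prod 𝓘(ℝ, EG))
      (Subtype.val : S.Composable → G × G) a :=
    (hS.composable_embedded.contMDiff a).mdifferentiableAt (by simp)
  have h3 := hgf.mfderiv_eq (I := 𝓘(ℝ, E₂)) (I' := 𝓘(ℝ, E₂))
  rw [mfderiv_comp a hg hval, mfderiv_id] at h3
  have h4 : (mfderiv (𝓘(ℝ, EG).prod 𝓘(ℝ, EG)) 𝓘(ℝ, E₂) g a.1)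
      (mfderiv 𝓘(ℝ, E₂) (𝓘(ℝ, EG).prod 𝓘(ℝ, EG)) (Subtype.val : S.Composable → G × G) a ξ) = ξ :=
    DFunLike.congr_fun h3 ξ
  rw [← h4]
  exact (congrArg _ hv).trans (map_zero _)

end IsLie
end GroupoidOn

/-! ### Groupoid identities and their differentials in the tangent groupoid. -/

namespace GroupoidOn

variable {X G : Type*} {S : GroupoidOn X G}

/-- The composable pair of units at `x`. -/
def unitPair (S : GroupoidOn X G) (x : X) : S.Composable :=
  ⟨(S.unit x, S.unit x), (S.src_unit x).trans (S.tgt_unit x).symm⟩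

theorem mul_unitPair (x : X) : S.mul (S.unitPair x) = S.unit x := by
  have h : S.unitPair x = ⟨(S.unit (S.tgt (S.unit x)), S.unit x), S.src_unit _⟩ :=
    Subtype.ext (Prod.ext (congrArg S.unit (S.tgt_unit x).symm) rfl)
  rw [h, S.unit_mul]

theorem inv_mul_mul (a : S.Composable) :
    S.mul ⟨(S.inv (S.pr₁ a), S.mul a), (S.src_inv _).trans (S.tgt_mul a).symm⟩ = S.pr₂ a := by
  have h1 := S.mul_assoc (S.inv (S.pr₁ a)) (S.pr₁ a) (S.pr₂ a) (S.src_inv _) a.2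
  refine h1.symm.trans ?_
  -- The unit is generalised to a variable `k`, since rewriting it in place would break the
  -- composability proof that depends on it.
  have h2 : ∀ (k : G) (hk : k = S.unit (S.tgt (S.pr₂ a))) (h : S.src k = S.tgt (S.pr₂ a)),
      S.mul ⟨(k, S.pr₂ a), h⟩ = S.pr₂ a := by
    rintro k rfl h
    exact S.unit_mul _
  exact h2 _ ((S.inv_mul _).trans (congrArg S.unit a.2)) _

theorem inv_unit (x : X) : S.inv (S.unit x) = S.unit x := by
  have h1 := S.mul_inv (S.unit x)
  have h2 : ∀ (y : X) (hy : y = S.tgt (S.inv (S.unit x))) (h : S.src (S.unit y) = _),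
      S.mul ⟨(S.unit y, S.inv (S.unit x)), h⟩ = S.inv (S.unit x) := by
    rintro y rfl h
    exact S.unit_mul _
  rw [h2 x (by rw [S.tgt_inv, S.src_unit])] at h1
  rw [h1, S.tgt_unit]

/-- Evaluate `(g⁻¹)⁻¹ (g⁻¹ g)` in two ways: cancellation gives `g`, and `g⁻¹ g` being a unit gives
`(g⁻¹)⁻¹`. -/
theorem inv_inv (S : GroupoidOn X G) (g : G) : S.inv (S.inv g) = g := by
  have h1 := inv_mul_mul (S := S) ⟨(S.inv g, g), S.src_inv g⟩
  have h2 : ∀ (k : G) (hk : k = S.unit (S.src (S.inv (S.inv g)))) (h : S.src _ = S.tgt k),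
      S.mul ⟨(S.inv (S.inv g), k), h⟩ = S.inv (S.inv g) := by
    rintro k rfl h
    exact S.mul_unit _
  rw [h2 _ ((S.inv_mul g).trans (by rw [S.src_inv, S.tgt_inv]))] at h1
  exact h1

variable
  {EX : Type*} [NormedAddCommGroup EX] [NormedSpace ℝ EX]
  [TopologicalSpace X] [ChartedSpace EX X]
  {EG : Type*} [NormedAddCommGroup EG] [NormedSpace ℝ EG]
  [TopologicalSpace G] [ChartedSpace EG G]
  {E₂ : Type*} [NormedAddCommGroup E₂] [NormedSpace ℝ E₂]
  [ChartedSpace E₂ S.Composable]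

namespace IsLie

theorem mdifferentiableAt_src (hS : S.IsLie EX EG E₂) (g : G) :
    MDifferentiableAt 𝓘(ℝ, EG) 𝓘(ℝ, EX) S.src g :=
  (hS.contMDiff_src g).mdifferentiableAt (by simp)

theorem mdifferentiableAt_tgt (hS : S.IsLie EX EG E₂) (g : G) :
    MDifferentiableAt 𝓘(ℝ, EG) 𝓘(ℝ, EX) S.tgt g :=
  (hS.contMDiff_tgt g).mdifferentiableAt (by simp)

theorem mdifferentiableAt_unit (hS : S.IsLie EX EG E₂) (x : X) :
    MDifferentiableAt 𝓘(ℝ, EX) 𝓘(ℝ, EG) S.unit x :=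
  (hS.unit_smooth x).mdifferentiableAt (by simp)

theorem mdifferentiableAt_inv (hS : S.IsLie EX EG E₂) (g : G) :
    MDifferentiableAt 𝓘(ℝ, EG) 𝓘(ℝ, EG) S.inv g :=
  (hS.inv_smooth g).mdifferentiableAt (by simp)

theorem mdifferentiableAt_pr₁ (hS : S.IsLie EX EG E₂) (a : S.Composable) :
    MDifferentiableAt 𝓘(ℝ, E₂) 𝓘(ℝ, EG) S.pr₁ a :=
  (hS.contMDiff_pr₁ a).mdifferentiableAt (by simp)

theorem mdifferentiableAt_pr₂ (hS : S.IsLie EX EG E₂) (a : S.Composable) :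
    MDifferentiableAt 𝓘(ℝ, E₂) 𝓘(ℝ, EG) S.pr₂ a :=
  (hS.contMDiff_pr₂ a).mdifferentiableAt (by simp)

theorem mdifferentiableAt_mul (hS : S.IsLie EX EG E₂) (a : S.Composable) :
    MDifferentiableAt 𝓘(ℝ, E₂) 𝓘(ℝ, EG) S.mul a :=
  (hS.mul_smooth a).mdifferentiableAt (by simp)

theorem modelDeriv_tgt_pr₂ (hS : S.IsLie EX EG E₂) (a : S.Composable) (ξ : E₂) :
    modelDeriv EG EX S.tgt (S.pr₂ a) (modelDeriv E₂ EG S.pr₂ a ξ) =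
      modelDeriv EG EX S.src (S.pr₁ a) (modelDeriv E₂ EG S.pr₁ a ξ) := by
  rw [← modelDeriv_comp_apply a (hS.mdifferentiableAt_tgt _) (hS.mdifferentiableAt_pr₂ a),
    ← modelDeriv_comp_apply a (hS.mdifferentiableAt_src _) (hS.mdifferentiableAt_pr₁ a)]
  have h : S.tgt ∘ S.pr₂ = S.src ∘ S.pr₁ := funext fun b => (S.src_pr₁ b).symm
  rw [h]

theorem modelDeriv_tgt_mul (hS : S.IsLie EX EG E₂) (a : S.Composable) (ξ : E₂) :
    modelDeriv EG EX S.tgt (S.mul a) (modelDeriv E₂ EG S.mul a ξ) =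
      modelDeriv EG EX S.tgt (S.pr₁ a) (modelDeriv E₂ EG S.pr₁ a ξ) := by
  rw [← modelDeriv_comp_apply a (hS.mdifferentiableAt_tgt _) (hS.mdifferentiableAt_mul a),
    ← modelDeriv_comp_apply a (hS.mdifferentiableAt_tgt _) (hS.mdifferentiableAt_pr₁ a)]
  have h : S.tgt ∘ S.mul = S.tgt ∘ S.pr₁ := funext fun b => S.tgt_mul b
  rw [h]

theorem modelDeriv_tgt₂ (hS : S.IsLie EX EG E₂) (a : S.Composable) (ξ : E₂) :
    modelDeriv E₂ EX S.tgt₂ a ξ =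
      modelDeriv EG EX S.tgt (S.pr₁ a) (modelDeriv E₂ EG S.pr₁ a ξ) :=
  modelDeriv_comp_apply a (hS.mdifferentiableAt_tgt _) (hS.mdifferentiableAt_pr₁ a) ξ

theorem modelDeriv_tgt_unit (hS : S.IsLie EX EG E₂) (x : X) (v : EX) :
    modelDeriv EG EX S.tgt (S.unit x) (modelDeriv EX EG S.unit x v) = v := by
  rw [← modelDeriv_comp_apply x (hS.mdifferentiableAt_tgt _) (hS.mdifferentiableAt_unit x)]
  have h : S.tgt ∘ S.unit = id := funext S.tgt_unit
  rw [h, modelDeriv_id]; rfl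

theorem modelDeriv_src_inv (hS : S.IsLie EX EG E₂) (g : G) (v : EG) :
    modelDeriv EG EX S.src (S.inv g) (modelDeriv EG EG S.inv g v) = modelDeriv EG EX S.tgt g v := by
  rw [← modelDeriv_comp_apply g (hS.mdifferentiableAt_src _) (hS.mdifferentiableAt_inv g)]
  have h : S.src ∘ S.inv = S.tgt := funext S.src_inv
  rw [h]

theorem modelDeriv_tgt_surjective [IsManifold 𝓘(ℝ, EX) ∞ X] (hS : S.IsLie EX EG E₂) (g : G) :
    Function.Surjective (modelDeriv EG EX S.tgt g) :=
  (hS.tgt_submersion.isSubmersionAt g).modelDeriv_surjective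

variable [IsManifold 𝓘(ℝ, EG) ∞ G] [IsManifold 𝓘(ℝ, E₂) ∞ S.Composable]

/-- Pairs of smooth maps with composable values have composable velocities. -/
theorem exists_tangent {EM M : Type*} [NormedAddCommGroup EM] [NormedSpace ℝ EM]
    [TopologicalSpace M] [ChartedSpace EM M] (hS : S.IsLie EX EG E₂) {f₁ f₂ : M → G}
    (h₁ : ContMDiff 𝓘(ℝ, EM) 𝓘(ℝ, EG) ∞ f₁) (h₂ : ContMDiff 𝓘(ℝ, EM) 𝓘(ℝ, EG) ∞ f₂)
    (h : ∀ z, S.src (f₁ z) = S.tgt (f₂ z)) (z : M) (w : EM) :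
    ∃ ξ : E₂, modelDeriv E₂ EG S.pr₁ ⟨(f₁ z, f₂ z), h z⟩ ξ = modelDeriv EM EG f₁ z w ∧
      modelDeriv E₂ EG S.pr₂ ⟨(f₁ z, f₂ z), h z⟩ ξ = modelDeriv EM EG f₂ z w ∧
      modelDeriv E₂ EG S.mul ⟨(f₁ z, f₂ z), h z⟩ ξ =
        modelDeriv EM EG (fun z => S.mul ⟨(f₁ z, f₂ z), h z⟩) z w := by
  let F : M → S.Composable := fun z => ⟨(f₁ z, f₂ z), h z⟩
  have hF : ContMDiff 𝓘(ℝ, EM) 𝓘(ℝ, E₂) ∞ F := hS.contMDiff_of_comp h₁ h₂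
  have hd := (hF z).mdifferentiableAt (by simp)
  exact ⟨modelDeriv EM E₂ F z w,
    (modelDeriv_comp_apply z (hS.mdifferentiableAt_pr₁ (F z)) hd w).symm,
    (modelDeriv_comp_apply z (hS.mdifferentiableAt_pr₂ (F z)) hd w).symm,
    (modelDeriv_comp_apply z (hS.mdifferentiableAt_mul (F z)) hd w).symm⟩

theorem exists_tangent_mul_unit (hS : S.IsLie EX EG E₂) (x : X) (w : EG) :
    ∃ ξ : E₂, modelDeriv E₂ EG S.pr₁ (S.unitPair x) ξ = w ∧
      modelDeriv E₂ EG S.pr₂ (S.unitPair x) ξ =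
        modelDeriv EX EG S.unit x (modelDeriv EG EX S.src (S.unit x) w) ∧
      modelDeriv E₂ EG S.mul (S.unitPair x) ξ = w := by
  have key := hS.exists_tangent (contMDiff_id (I := 𝓘(ℝ, EG)) (M := G))
    (hS.unit_smooth.comp hS.contMDiff_src) (fun g => (S.tgt_unit _).symm) (S.unit x) w
  have hp : (⟨(id (S.unit x), (S.unit ∘ S.src) (S.unit x)), (S.tgt_unit _).symm⟩ : S.Composable) =
      S.unitPair x := Subtype.ext (Prod.ext rfl (congrArg S.unit (S.src_unit x)))
  have hm : (fun g => S.mul ⟨(id g, (S.unit ∘ S.src) g), (S.tgt_unit _).symm⟩) = id :=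
    funext S.mul_unit
  rw [hp, hm, modelDeriv_id, modelDeriv_comp_apply (S.unit x) (hS.mdifferentiableAt_unit _)
    (hS.mdifferentiableAt_src _), S.src_unit] at key
  exact key

theorem exists_tangent_unit_mul (hS : S.IsLie EX EG E₂) (x : X) (w : EG) :
    ∃ ξ : E₂, modelDeriv E₂ EG S.pr₁ (S.unitPair x) ξ =
        modelDeriv EX EG S.unit x (modelDeriv EG EX S.tgt (S.unit x) w) ∧
      modelDeriv E₂ EG S.pr₂ (S.unitPair x) ξ = w ∧
      modelDeriv E₂ EG S.mul (S.unitPair x) ξ = w := by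
  have key := hS.exists_tangent (hS.unit_smooth.comp hS.contMDiff_tgt)
    (contMDiff_id (I := 𝓘(ℝ, EG)) (M := G)) (fun g => S.src_unit _) (S.unit x) w
  have hp : (⟨((S.unit ∘ S.tgt) (S.unit x), id (S.unit x)), S.src_unit _⟩ : S.Composable) =
      S.unitPair x := Subtype.ext (Prod.ext (congrArg S.unit (S.tgt_unit x)) rfl)
  have hm : (fun g => S.mul ⟨((S.unit ∘ S.tgt) g, id g), S.src_unit _⟩) = id :=
    funext S.unit_mul
  rw [hp, hm, modelDeriv_id, modelDeriv_comp_apply (S.unit x) (hS.mdifferentiableAt_unit _)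
    (hS.mdifferentiableAt_tgt _), S.tgt_unit] at key
  exact key

theorem exists_tangent_inv (hS : S.IsLie EX EG E₂) (g : G) (w : EG) :
    ∃ ξ : E₂, modelDeriv E₂ EG S.pr₁ ⟨(g, S.inv g), (S.tgt_inv g).symm⟩ ξ = w ∧
      modelDeriv E₂ EG S.pr₂ ⟨(g, S.inv g), (S.tgt_inv g).symm⟩ ξ = modelDeriv EG EG S.inv g w ∧
      modelDeriv E₂ EG S.mul ⟨(g, S.inv g), (S.tgt_inv g).symm⟩ ξ =
        modelDeriv EX EG S.unit (S.tgt g) (modelDeriv EG EX S.tgt g w) := by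
  have key := hS.exists_tangent (contMDiff_id (I := 𝓘(ℝ, EG)) (M := G)) hS.inv_smooth
    (fun g => (S.tgt_inv g).symm) g w
  have hm : (fun g => S.mul ⟨(id g, S.inv g), (S.tgt_inv g).symm⟩) = S.unit ∘ S.tgt :=
    funext S.mul_inv
  rw [hm, modelDeriv_id, modelDeriv_comp_apply g (hS.mdifferentiableAt_unit _)
    (hS.mdifferentiableAt_tgt _)] at key
  exact key

/-- Idempotents of the tangent groupoid over units are units. -/
theorem eq_modelDeriv_unit (hS : S.IsLie EX EG E₂) {x : X} {w : EG} {ξ : E₂}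
    (h₁ : modelDeriv E₂ EG S.pr₁ (S.unitPair x) ξ = w)
    (h₂ : modelDeriv E₂ EG S.pr₂ (S.unitPair x) ξ = w)
    (hm : modelDeriv E₂ EG S.mul (S.unitPair x) ξ = w) :
    w = modelDeriv EX EG S.unit x (modelDeriv EG EX S.tgt (S.unit x) w) := by
  have hst : modelDeriv EG EX S.tgt (S.unit x) w = modelDeriv EG EX S.src (S.unit x) w := by
    have := hS.modelDeriv_tgt_pr₂ (S.unitPair x) ξ
    rwa [h₁, h₂] at this
  -- Decompose `(w, w) = (w, du ds w) + (0, w - du ds w)`. The products of the summands are `w` and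
  -- `w - du ds w`, so linearity of `dm` gives `w = w + (w - du ds w)`.
  obtain ⟨ξ₁, a₁, b₁, c₁⟩ := hS.exists_tangent_mul_unit x w
  obtain ⟨ξ₂, a₂, b₂, c₂⟩ := hS.exists_tangent_unit_mul x
    (w - modelDeriv EX EG S.unit x (modelDeriv EG EX S.src (S.unit x) w))
  rw [map_sub, hS.modelDeriv_tgt_unit, hst, sub_self, map_zero] at a₂
  have h0 : ξ - ξ₁ - ξ₂ = 0 := by
    refine hS.eq_zero_of_modelDeriv_pr (a := S.unitPair x) ?_ ?_
    · simp only [map_sub, h₁, a₁, a₂, sub_self]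
    · simp only [map_sub, h₂, b₁, b₂, sub_self]
  have h3 : modelDeriv E₂ EG S.mul (S.unitPair x) (ξ - ξ₁ - ξ₂) = 0 := by rw [h0, map_zero]
  rw [map_sub, map_sub, hm, c₁, c₂, sub_self, zero_sub, neg_eq_zero, sub_eq_zero] at h3
  rw [hst]
  exact h3

/-- Left translation by a fixed arrow is injective on tangent vectors. -/
theorem modelDeriv_pr₂_eq_zero (hS : S.IsLie EX EG E₂) {a : S.Composable} {ξ : E₂}
    (h₁ : modelDeriv E₂ EG S.pr₁ a ξ = 0) (hm : modelDeriv E₂ EG S.mul a ξ = 0) :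
    modelDeriv E₂ EG S.pr₂ a ξ = 0 := by
  -- Differentiate `g⁻¹ (g h) = h`: both components of the velocity `ζ` of `(g⁻¹, g h)` vanish, so
  -- `ζ = 0` and so does its product.
  obtain ⟨ζ, a₁, b₁, c₁⟩ := hS.exists_tangent (hS.inv_smooth.comp hS.contMDiff_pr₁) hS.mul_smooth
    (fun b => (S.src_inv _).trans (S.tgt_mul b).symm) a ξ
  rw [modelDeriv_comp_apply a (hS.mdifferentiableAt_inv _) (hS.mdifferentiableAt_pr₁ a), h₁,
    map_zero] at a₁
  rw [hm] at b₁
  have hζ := hS.eq_zero_of_modelDeriv_pr a₁ b₁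
  rw [hζ, map_zero] at c₁
  have hF : (fun b => S.mul ⟨((S.inv ∘ S.pr₁) b, S.mul b),
      (S.src_inv _).trans (S.tgt_mul b).symm⟩) = S.pr₂ := funext S.inv_mul_mul
  rw [hF] at c₁
  exact c₁.symm

end IsLie
end GroupoidOn

/-! ### Casts and frame changes between tangent spaces of `X`. -/

section Coordinates

variable {EP : Type*} [NormedAddCommGroup EP] [NormedSpace ℝ EP]
  {P : Type*} [TopologicalSpace P] [ChartedSpace EP P]
  {EX : Type*} [NormedAddCommGroup EX] [NormedSpace ℝ EX]
  {X : Type*} [TopologicalSpace X] [ChartedSpace EX X]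

/-- All tangent spaces are definitionally the model space `EX`, so casts along equal base points
become invisible once equality is taken in `EX`. -/
theorem tangentCast_apply {x y : X} (h : x = y) (v : TangentSpace 𝓘(ℝ, EX) x) :
    @Eq EX (tangentCast h v) v := by
  subst h; rfl

variable [IsManifold 𝓘(ℝ, EX) ∞ X] {q : ℕ}

/-- A smooth differential form is differentiable. -/
theorem formDifferentiableAt_of_smooth {α : X → EX [⋀^Fin q]→L[ℝ] ℝ}
    (hα : ∀ x, ContMDiffAt 𝓘(ℝ, EX) 𝓘(ℝ, EX [⋀^Fin q]→L[ℝ] ℝ) ∞ (cochainCoord (fun x => x) α x) x)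
    (x : X) : FormDifferentiableAt α x := by
  have h := formDifferentiableAt_comp (σ := fun z : X => z) continuousAt_id
    ((hα x).mdifferentiableAt (by simp)) (mdifferentiableAt_bundleMapCoord_modelDeriv contMDiff_id x)
  have e : (fun z => (α z).compContinuousLinearMap (modelDeriv EX EX (id : X → X) z)) = α := by
    funext z; rw [modelDeriv_id]; rfl
  rwa [e] at h

/-- The frame changes on the intermediate bundle `σ^* TX` cancel, so the local expression of a
composite is a composite of local expressions. -/
theorem bundleMapCoord_comp_eventuallyEq [IsManifold 𝓘(ℝ, EP) ∞ P] {σ σ' : P → X}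
    (T : P → EX →L[ℝ] EX) (B : P → EP →L[ℝ] EX) {p₀ : P} (hσ : ContinuousAt σ p₀)
    (hσ' : ContinuousAt σ' p₀) :
    bundleMapCoord EP σ' (fun p => T p ∘L B p) p₀ =ᶠ[𝓝 p₀] fun p =>
      inTangentCoordinates 𝓘(ℝ, EX) 𝓘(ℝ, EX) σ σ' T p₀ p ∘L bundleMapCoord EP σ B p₀ p := by
  filter_upwards [chart_source_mem_nhds EP p₀,
    hσ.eventually_mem (chart_source_mem_nhds EX (σ p₀)),
    hσ'.eventually_mem (chart_source_mem_nhds EX (σ' p₀))] with p hp h h'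
  rw [bundleMapCoord, bundleMapCoord, inTangentCoordinates_eq _ _ _ hp h',
    inTangentCoordinates_eq _ _ _ h h', inTangentCoordinates_eq _ _ _ hp h]
  have hinv (w : EX) : tangentCoordChange 𝓘(ℝ, EX) (σ p₀) (σ p) (σ p)
      (tangentCoordChange 𝓘(ℝ, EX) (σ p) (σ p₀) (σ p) w) = w := by
    have hs : σ p ∈ (extChartAt 𝓘(ℝ, EX) (σ p₀)).source := by simpa using h
    rw [tangentCoordChange_comp ⟨⟨mem_extChartAt_source _, hs⟩, mem_extChartAt_source _⟩,
      tangentCoordChange_self (mem_extChartAt_source _)]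
  ext v
  exact congrArg (fun w => (tangentBundleCore 𝓘(ℝ, EX) X).coordChange (achart EX (σ' p))
    (achart EX (σ' p₀)) (σ' p) (T p w)) (hinv _).symm

end Coordinates

/-! ### Horizontal lifts and `d_C` on the model spaces. -/

namespace EhresmannConnection

variable {EP : Type*} [NormedAddCommGroup EP] [NormedSpace ℝ EP]
  {P : Type*} [TopologicalSpace P] [ChartedSpace EP P] [IsManifold 𝓘(ℝ, EP) ∞ P]
  {EX : Type*} [NormedAddCommGroup EX] [NormedSpace ℝ EX] [FiniteDimensional ℝ EX]
  {X : Type*} [TopologicalSpace X] [ChartedSpace EX X]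
  {τ : P → X} (C : EhresmannConnection EP EX τ) {q : ℕ}

/-- The horizontal lifting, as a map between the model spaces. -/
def lift (p : P) : EX →L[ℝ] EP := C.hor p

theorem lift_modelDeriv {p : P} {w : EP} (hw : w ∈ C.fiber p) :
    C.lift p (modelDeriv EP EX τ p w) = w := C.hor_mfderiv p hw

theorem lift_mem (p : P) (v : EX) : C.lift p v ∈ C.fiber p := C.hor_mem p v

theorem modelDeriv_lift {p : P} (hτ : Function.Surjective (modelDeriv EP EX τ p)) (v : EX) :
    modelDeriv EP EX τ p (C.lift p v) = v := C.mfderiv_hor p hτ v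

theorem d_apply (c : P → EX [⋀^Fin q]→L[ℝ] ℝ) (p : P)
    (v : Fin (q + 1) → EX) :
    C.d c p v = formDeriv (fun z => (c z).compContinuousLinearMap (modelDeriv EP EX τ z)) p (fun i => C.lift p (v i)) :=
  congrArg (fun η : EP [⋀^Fin (q + 1)]→L[ℝ] ℝ => η (fun i => C.lift p (v i)))
    (mExtDeriv_eq_formDeriv (fun z => (c z).compContinuousLinearMap (modelDeriv EP EX τ z)) p)

theorem d_zeroCochain_apply {f : P → ℝ} {p : P} (hf : MDifferentiableAt 𝓘(ℝ, EP) 𝓘(ℝ, ℝ) f p)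
    (v : Fin 1 → EX) :
    C.d (GroupoidOn.zeroCochain τ f) p v = modelDeriv EP ℝ f p (C.lift p (v 0)) :=
  (C.d_apply (fun z => ContinuousAlternatingMap.constOfIsEmpty ℝ EX (Fin 0) (f z)) p v).trans
    (formDeriv_constOfIsEmpty f p (fun i => C.lift p (v i)) hf)

end EhresmannConnection

/-! ### The action on `TX` and the groupoid differentials on the model spaces. -/

namespace GroupoidOn

variable {X G : Type*} {S : GroupoidOn X G}
  {EX : Type*} [NormedAddCommGroup EX] [NormedSpace ℝ EX]
  [TopologicalSpace X] [ChartedSpace EX X] [IsManifold 𝓘(ℝ, EX) ∞ X]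
  {EG : Type*} [NormedAddCommGroup EG] [NormedSpace ℝ EG]
  [TopologicalSpace G] [ChartedSpace EG G]
  (A : S.TangentAction EX EG) {q : ℕ}

namespace TangentAction

/-- The right action of arrows, as a map between the model spaces. -/
def modelPull (g : G) : EX →L[ℝ] EX := A.pull g

theorem modelPull_eq (g : G) : A.modelPull g = A.act (S.inv g) := by
  ext v
  refine (tangentCast_apply (EX := EX) _ _).trans ?_
  exact congrArg (fun w : EX => (A.act (S.inv g) : EX →L[ℝ] EX) w) (tangentCast_apply (EX := EX) _ _)

theorem modelPull_unit (x : X) : A.modelPull (S.unit x) = ContinuousLinearMap.id ℝ EX := by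
  rw [modelPull_eq, inv_unit]
  ext v
  have h := A.act_unit x v
  have h1 := tangentCast_apply (EX := EX) (S.src_unit x).symm v
  have h2 := tangentCast_apply (EX := EX) (S.tgt_unit x).symm v
  have h3 : @Eq EX (A.act (S.unit x) (tangentCast (S.src_unit x).symm v)) v := h.trans h2
  refine Eq.trans ?_ h3
  exact congrArg (fun w : EX => (A.act (S.unit x) : EX →L[ℝ] EX) w) h1.symm

theorem shift_apply (c : G → EX [⋀^Fin q]→L[ℝ] ℝ)
    (a : S.Composable) (v : Fin q → EX) :
    A.shift c a v = (c (S.pr₂ a)) (fun i => A.modelPull (S.pr₁ a) (v i)) :=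
  congrArg (fun w : Fin q → EX => c (S.pr₂ a) w) (funext fun _ => tangentCast_apply (EX := EX) _ _)

theorem δ₀_apply (α : X → EX [⋀^Fin q]→L[ℝ] ℝ) (g : G) (v : Fin q → EX) :
    A.δ₀ α g v = (α (S.src g)) (fun i => A.modelPull g (v i)) -
      (α (S.tgt g)) v := rfl

theorem δ₁_apply (c : G → EX [⋀^Fin q]→L[ℝ] ℝ)
    (a : S.Composable) (v : Fin q → EX) :
    A.δ₁ c a v = (c (S.pr₂ a)) (fun i => A.modelPull (S.pr₁ a) (v i)) -
      (c (S.mul a)) v + (c (S.pr₁ a)) v := by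
  rw [← A.shift_apply]
  refine congrArg (fun r => A.shift c a v - r + (c (S.pr₁ a)) v) ?_
  exact congrArg (fun w : Fin q → EX => c (S.mul a) w) (funext fun _ => tangentCast_apply (EX := EX) _ _)

/-- Since `g^*` is the action of `τ g`, this is smoothness of the action composed with inversion,
which exchanges `src` and `tgt`. -/
theorem contMDiffAt_modelPull (hinv : ContMDiff 𝓘(ℝ, EG) 𝓘(ℝ, EG) ∞ S.inv) (g : G) :
    ContMDiffAt 𝓘(ℝ, EG) 𝓘(ℝ, EX →L[ℝ] EX) ∞
      (inTangentCoordinates 𝓘(ℝ, EX) 𝓘(ℝ, EX) S.tgt S.src A.modelPull g) g := by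
  have h := (A.smooth (S.inv g)).comp g (hinv g)
  have e : (inTangentCoordinates 𝓘(ℝ, EX) 𝓘(ℝ, EX) S.src S.tgt A.act (S.inv g)) ∘ S.inv =
      inTangentCoordinates 𝓘(ℝ, EX) 𝓘(ℝ, EX) (S.src ∘ S.inv) (S.tgt ∘ S.inv)
        (fun g => A.modelPull g) g := by
    funext z
    simp only [modelPull_eq]
    rfl
  rw [e, show S.src ∘ S.inv = S.tgt from funext S.src_inv,
    show S.tgt ∘ S.inv = S.src from funext S.tgt_inv] at h
  exact h

end TangentAction

/-- The bundle map `g^* ∘ dt` turns a shifted cochain into a horizontal form. It is used with `f =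
id` for `g · α(s g)` and with `f = pr₁` for `g₁ · c(g₂)`. -/
theorem mdifferentiableAt_bundleMapCoord_modelPull {EP P : Type*} [NormedAddCommGroup EP]
    [NormedSpace ℝ EP] [TopologicalSpace P] [ChartedSpace EP P] [IsManifold 𝓘(ℝ, EP) ∞ P]
    {E₂ : Type*} [NormedAddCommGroup E₂]
    [NormedSpace ℝ E₂] [ChartedSpace E₂ S.Composable] (hS : S.IsLie EX EG E₂) {f : P → G}
    (hf : ContMDiff 𝓘(ℝ, EP) 𝓘(ℝ, EG) ∞ f) (p : P) :
    MDifferentiableAt 𝓘(ℝ, EP) 𝓘(ℝ, EP →L[ℝ] EX) (bundleMapCoord EP (S.src ∘ f)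
      (fun z => A.modelPull (f z) ∘L modelDeriv EP EX (S.tgt ∘ f) z) p) p := by
  have ht := hS.contMDiff_tgt.comp hf
  have hs := hS.contMDiff_src.comp hf
  have h1 : MDifferentiableAt 𝓘(ℝ, EP) 𝓘(ℝ, EX →L[ℝ] EX)
      (inTangentCoordinates 𝓘(ℝ, EX) 𝓘(ℝ, EX) (S.tgt ∘ f) (S.src ∘ f)
        (fun z => A.modelPull (f z)) p) p :=
    ((A.contMDiffAt_modelPull hS.inv_smooth (f p)).comp p (hf p)).mdifferentiableAt (by simp)
  refine MDifferentiableAt.congr_of_eventuallyEq ?_ (bundleMapCoord_comp_eventuallyEq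
    (fun z => A.modelPull (f z)) (modelDeriv EP EX (S.tgt ∘ f)) ht.continuous.continuousAt
    hs.continuous.continuousAt)
  exact h1.clm_comp (mdifferentiableAt_bundleMapCoord_modelDeriv ht p)

end GroupoidOn

section ZeroForms

variable {EP : Type*} [NormedAddCommGroup EP] [NormedSpace ℝ EP]
  {P : Type*} [TopologicalSpace P] [ChartedSpace EP P]
  {EX : Type*} [NormedAddCommGroup EX] [NormedSpace ℝ EX]
  {X : Type*} [TopologicalSpace X] [ChartedSpace EX X] [IsManifold 𝓘(ℝ, EX) ∞ X]

theorem contMDiffAt_cochainCoord_constOfIsEmpty (τ : P → X) {f : P → ℝ}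
    (hf : ContMDiff 𝓘(ℝ, EP) 𝓘(ℝ, ℝ) ∞ f) (p : P) :
    ContMDiffAt 𝓘(ℝ, EP) 𝓘(ℝ, EX [⋀^Fin 0]→L[ℝ] ℝ) ∞ (cochainCoord τ
      (fun z => ContinuousAlternatingMap.constOfIsEmpty ℝ EX (Fin 0) (f z)) p) p := by
  have h : cochainCoord τ (fun z => ContinuousAlternatingMap.constOfIsEmpty ℝ EX (Fin 0) (f z)) p =
      ContinuousAlternatingMap.constOfIsEmptyLIE ℝ EX ℝ (Fin 0) ∘ f := rfl
  rw [h]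
  exact (ContinuousAlternatingMap.constOfIsEmptyLIE ℝ EX ℝ (Fin 0)).contDiff.contMDiff.comp hf p

end ZeroForms

/-! ### Consequences of the derivation identity for the lift of `C₂`. -/

namespace GroupoidOn

variable {X G : Type*} {S : GroupoidOn X G}
  {EX : Type*} [NormedAddCommGroup EX] [NormedSpace ℝ EX] [FiniteDimensional ℝ EX]
  [TopologicalSpace X] [ChartedSpace EX X] [IsManifold 𝓘(ℝ, EX) ∞ X]
  {EG : Type*} [NormedAddCommGroup EG] [NormedSpace ℝ EG]
  [TopologicalSpace G] [ChartedSpace EG G] [IsManifold 𝓘(ℝ, EG) ∞ G]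
  {E₂ : Type*} [NormedAddCommGroup E₂] [NormedSpace ℝ E₂]
  [ChartedSpace E₂ S.Composable]
  {A : S.TangentAction EX EG} {C : EhresmannConnection EG EX S.tgt}

/-- Compatibility of the action with the connection, in terms of forms on the model spaces. -/
theorem CommutesRow₀₁.formDeriv_eq (hA : CommutesRow₀₁ A C) {q : ℕ} {α : X → EX [⋀^Fin q]→L[ℝ] ℝ}
    (hα : ∀ x, ContMDiffAt 𝓘(ℝ, EX) 𝓘(ℝ, EX [⋀^Fin q]→L[ℝ] ℝ) ∞ (cochainCoord (fun x => x) α x) x)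
    (g : G) (v : Fin (q + 1) → EX) :
    formDeriv (fun z => ((α (S.src z)).compContinuousLinearMap (A.modelPull z) -
        α (S.tgt z)).compContinuousLinearMap (modelDeriv EG EX S.tgt z)) g
          (fun i => C.lift g (v i)) =
      formDeriv α (S.src g) (fun i => A.modelPull g (v i)) - formDeriv α (S.tgt g) v := by
  have h1 := hA q α hα
  have h2 : @Eq ℝ (C.d (A.δ₀ α) g v) (A.δ₀ (mExtDeriv α) g v) :=
    congrArg (fun c : G → EX [⋀^Fin (q + 1)]→L[ℝ] ℝ => c g v) h1
  refine ((C.d_apply (A.δ₀ α) g v).symm.trans h2).trans ?_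
  refine (A.δ₀_apply (mExtDeriv α) g v).trans ?_
  exact congrArg₂ (fun η θ : EX [⋀^Fin (q + 1)]→L[ℝ] ℝ => η (fun i => A.modelPull g (v i)) - θ v)
    (mExtDeriv_eq_formDeriv α (S.src g)) (mExtDeriv_eq_formDeriv α (S.tgt g))

variable [IsManifold 𝓘(ℝ, E₂) ∞ S.Composable] {C₂ : EhresmannConnection E₂ EX S.tgt₂}

theorem DerivationOnFunctions.modelDeriv_eq (hC₂ : DerivationOnFunctions A C C₂)
    (hS : S.IsLie EX EG E₂) {f₁ f₂ : G → ℝ}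
    (h₁ : ContMDiff 𝓘(ℝ, EG) 𝓘(ℝ, ℝ) ∞ f₁) (h₂ : ContMDiff 𝓘(ℝ, EG) 𝓘(ℝ, ℝ) ∞ f₂)
    (a : S.Composable) (v : EX) :
    modelDeriv E₂ ℝ (fun b => f₁ (S.pr₁ b) * f₂ (S.pr₂ b)) a (C₂.lift a v) =
      f₂ (S.pr₂ a) * modelDeriv EG ℝ f₁ (S.pr₁ a) (C.lift (S.pr₁ a) v) +
        f₁ (S.pr₁ a) * modelDeriv EG ℝ f₂ (S.pr₂ a)
          (C.lift (S.pr₂ a) (A.modelPull (S.pr₁ a) v)) := by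
  have hp₁ : ContMDiff 𝓘(ℝ, E₂) 𝓘(ℝ, ℝ) ∞ (fun b => f₁ (S.pr₁ b)) := h₁.comp hS.contMDiff_pr₁
  have hp₂ : ContMDiff 𝓘(ℝ, E₂) 𝓘(ℝ, ℝ) ∞ (fun b => f₂ (S.pr₂ b)) := h₂.comp hS.contMDiff_pr₂
  have hp : MDifferentiableAt 𝓘(ℝ, E₂) 𝓘(ℝ, ℝ) (fun b => f₁ (S.pr₁ b) * f₂ (S.pr₂ b)) a :=
    ((hp₁.mul hp₂) a).mdifferentiableAt (by simp)
  have h := hC₂ f₁ f₂ h₁ h₂ a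
  have h' := congrArg (fun c : EX [⋀^Fin 1]→L[ℝ] ℝ => c (fun _ => v)) h
  refine (C₂.d_zeroCochain_apply hp (fun _ => v)).symm.trans (h'.trans ?_)
  refine congrArg₂ (fun r s : ℝ => f₂ (S.pr₂ a) * r + f₁ (S.pr₁ a) * s) ?_ ?_
  · exact C.d_zeroCochain_apply ((h₁ _).mdifferentiableAt (by simp)) (fun _ => v)
  · refine (A.shift_apply (C.d (zeroCochain S.tgt f₂)) a (fun _ => v)).trans ?_
    exact C.d_zeroCochain_apply ((h₂ _).mdifferentiableAt (by simp))
      (fun _ => A.modelPull (S.pr₁ a) v)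

variable [FiniteDimensional ℝ EG] [T2Space G]

/-- With `f₂ = 1` the derivation identity computes the derivative of every smooth `f₁` along the
first component, and smooth functions separate tangent vectors. -/
theorem DerivationOnFunctions.modelDeriv_pr₁_lift (hC₂ : DerivationOnFunctions A C C₂)
    (hS : S.IsLie EX EG E₂) (a : S.Composable) (v : EX) :
    modelDeriv E₂ EG S.pr₁ a (C₂.lift a v) = C.lift (S.pr₁ a) v := by
  refine eq_of_forall_modelDeriv_eq (x := S.pr₁ a) fun f hf => ?_
  have h := hC₂.modelDeriv_eq hS hf (contMDiff_const (c := (1 : ℝ))) a v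
  have h1 : modelDeriv EG ℝ (fun _ : G => (1 : ℝ)) (S.pr₂ a) = 0 := mfderiv_const
  simp only [mul_one, one_mul, h1, zero_apply, mul_zero, add_zero] at h
  rw [← h, ← modelDeriv_comp_apply a ((hf _).mdifferentiableAt (by simp))
    (hS.mdifferentiableAt_pr₁ a)]
  rfl

/-- The case `f₁ = 1`; here the shift by `g₁` in the cup product makes the action appear. -/
theorem DerivationOnFunctions.modelDeriv_pr₂_lift (hC₂ : DerivationOnFunctions A C C₂)
    (hS : S.IsLie EX EG E₂) (a : S.Composable) (v : EX) :
    modelDeriv E₂ EG S.pr₂ a (C₂.lift a v) = C.lift (S.pr₂ a) (A.modelPull (S.pr₁ a) v) := by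
  refine eq_of_forall_modelDeriv_eq (x := S.pr₂ a) fun f hf => ?_
  have h := hC₂.modelDeriv_eq hS (contMDiff_const (c := (1 : ℝ))) hf a v
  have h1 : modelDeriv EG ℝ (fun _ : G => (1 : ℝ)) (S.pr₁ a) = 0 := mfderiv_const
  simp only [one_mul, h1, zero_apply, mul_zero, zero_add] at h
  rw [← h, ← modelDeriv_comp_apply a ((hf _).mdifferentiableAt (by simp))
    (hS.mdifferentiableAt_pr₂ a)]
  rfl

theorem DerivationOnFunctions.modelDeriv_tgt₂_lift (hC₂ : DerivationOnFunctions A C C₂)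
    (hS : S.IsLie EX EG E₂) (a : S.Composable) (v : EX) :
    modelDeriv E₂ EX S.tgt₂ a (C₂.lift a v) = v := by
  rw [hS.modelDeriv_tgt₂, hC₂.modelDeriv_pr₁_lift hS,
    C.modelDeriv_lift (hS.modelDeriv_tgt_surjective _)]

/-- A vector tangent to the space of composable pairs with horizontal components is horizontal. -/
theorem DerivationOnFunctions.eq_lift (hC₂ : DerivationOnFunctions A C C₂)
    (hS : S.IsLie EX EG E₂) {a : S.Composable} {ξ : E₂}
    (h₁ : modelDeriv E₂ EG S.pr₁ a ξ ∈ C.fiber (S.pr₁ a))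
    (h₂ : modelDeriv E₂ EG S.pr₂ a ξ ∈ C.fiber (S.pr₂ a)) :
    ξ = C₂.lift a (modelDeriv E₂ EX S.tgt₂ a ξ) := by
  rw [← sub_eq_zero]
  have e₁ : modelDeriv E₂ EG S.pr₁ a (ξ - C₂.lift a (modelDeriv E₂ EX S.tgt₂ a ξ)) = 0 := by
    rw [map_sub, hC₂.modelDeriv_pr₁_lift hS, hS.modelDeriv_tgt₂, C.lift_modelDeriv h₁, sub_self]
  refine hS.eq_zero_of_modelDeriv_pr e₁ ?_
  have hm : modelDeriv E₂ EG S.pr₂ a (ξ - C₂.lift a (modelDeriv E₂ EX S.tgt₂ a ξ)) ∈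
      C.fiber (S.pr₂ a) := by
    rw [map_sub, hC₂.modelDeriv_pr₂_lift hS]
    exact Submodule.sub_mem _ h₂ (C.lift_mem _ _)
  -- The second component of the difference is horizontal, and its `dt` equals `ds` of the zero
  -- first component; such a vector is zero.
  rw [← C.lift_modelDeriv hm, hS.modelDeriv_tgt_pr₂, e₁, map_zero, map_zero]

theorem DerivationOnFunctions.mem_fiber_iff (hC₂ : DerivationOnFunctions A C C₂)
    (hS : S.IsLie EX EG E₂) (a : S.Composable) (ξ : E₂) :
    ξ ∈ C₂.fiber a ↔ modelDeriv E₂ EG S.pr₁ a ξ ∈ C.fiber (S.pr₁ a) ∧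
      modelDeriv E₂ EG S.pr₂ a ξ ∈ C.fiber (S.pr₂ a) := by
  constructor
  · intro h
    rw [← C₂.lift_modelDeriv h, hC₂.modelDeriv_pr₁_lift hS, hC₂.modelDeriv_pr₂_lift hS]
    exact ⟨C.lift_mem _ _, C.lift_mem _ _⟩
  · rintro ⟨h₁, h₂⟩
    rw [hC₂.eq_lift hS h₁ h₂]
    exact C₂.lift_mem _ _

/-- Closedness under the product, in terms of horizontal lifts. -/
theorem DerivationOnFunctions.closedUnderProduct_iff (hC₂ : DerivationOnFunctions A C C₂)
    (hS : S.IsLie EX EG E₂) :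
    S.ClosedUnderProduct E₂ C.fiber ↔
      ∀ (a : S.Composable) (v : EX),
        modelDeriv E₂ EG S.mul a (C₂.lift a v) = C.lift (S.mul a) v := by
  constructor
  · intro h a v
    have hmem : modelDeriv E₂ EG S.mul a (C₂.lift a v) ∈ C.fiber (S.mul a) :=
      h a (C₂.lift a v) ((hC₂.mem_fiber_iff hS a _).1 (C₂.lift_mem a v)).1
        ((hC₂.mem_fiber_iff hS a _).1 (C₂.lift_mem a v)).2
    rw [← C.lift_modelDeriv hmem, hS.modelDeriv_tgt_mul, ← hS.modelDeriv_tgt₂,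
      hC₂.modelDeriv_tgt₂_lift hS]
  · intro h a ξ h₁ h₂
    have e := hC₂.eq_lift hS (ξ := ξ) h₁ h₂
    have : modelDeriv E₂ EG S.mul a ξ ∈ C.fiber (S.mul a) := by
      rw [e, h]
      exact C.lift_mem _ _
    exact this

end GroupoidOn

/-! ### Multiplicativity, and comparison of `d δ` with `δ d` on 1-cochains. -/

namespace GroupoidOn

variable {X G : Type*} {S : GroupoidOn X G}
  {EX : Type*} [NormedAddCommGroup EX] [NormedSpace ℝ EX] [FiniteDimensional ℝ EX]
  [TopologicalSpace X] [ChartedSpace EX X] [IsManifold 𝓘(ℝ, EX) ∞ X]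
  {EG : Type*} [NormedAddCommGroup EG] [NormedSpace ℝ EG]
  [TopologicalSpace G] [ChartedSpace EG G] [IsManifold 𝓘(ℝ, EG) ∞ G]
  {q : ℕ}

theorem δ₁_d_apply (A : S.TangentAction EX EG) (C : EhresmannConnection EG EX S.tgt)
    (c : G → EX [⋀^Fin q]→L[ℝ] ℝ) (a : S.Composable) (v : Fin (q + 1) → EX) :
    A.δ₁ (C.d c) a v =
      formDeriv (fun z => (c z).compContinuousLinearMap (modelDeriv EG EX S.tgt z)) (S.pr₂ a)
        (fun i => C.lift (S.pr₂ a) (A.modelPull (S.pr₁ a) (v i))) -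
      formDeriv (fun z => (c z).compContinuousLinearMap (modelDeriv EG EX S.tgt z)) (S.mul a)
        (fun i => C.lift (S.mul a) (v i)) +
      formDeriv (fun z => (c z).compContinuousLinearMap (modelDeriv EG EX S.tgt z)) (S.pr₁ a)
        (fun i => C.lift (S.pr₁ a) (v i)) := by
  refine (A.δ₁_apply (C.d c) a v).trans ?_
  refine congrArg₂ (fun r s : ℝ => r + s) (congrArg₂ (fun r s : ℝ => r - s) ?_ ?_) ?_
  · exact C.d_apply c (S.pr₂ a) (fun i => A.modelPull (S.pr₁ a) (v i))
  · exact C.d_apply c (S.mul a) v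
  · exact C.d_apply c (S.pr₁ a) v

variable [FiniteDimensional ℝ EG] [T2Space G]
  {E₂ : Type*} [NormedAddCommGroup E₂] [NormedSpace ℝ E₂]
  [ChartedSpace E₂ S.Composable] [IsManifold 𝓘(ℝ, E₂) ∞ S.Composable]
  {A : S.TangentAction EX EG} {C : EhresmannConnection EG EX S.tgt}
  {C₂ : EhresmannConnection E₂ EX S.tgt₂}

/-- Units act trivially, so over a pair of units the lift has components `(w, w)`, and by assumption
its product is `w`. Idempotents over units are units. -/
theorem lift_unit (hS : S.IsLie EX EG E₂) (hC₂ : DerivationOnFunctions A C C₂)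
    (h : ∀ (a : S.Composable) (v : EX),
      modelDeriv E₂ EG S.mul a (C₂.lift a v) = C.lift (S.mul a) v) (x : X) (v : EX) :
    C.lift (S.unit x) v = modelDeriv EX EG S.unit x v := by
  have hm := h (S.unitPair x) v
  rw [mul_unitPair] at hm
  have h₁ : modelDeriv E₂ EG S.pr₁ (S.unitPair x) (C₂.lift (S.unitPair x) v) =
    C.lift (S.unit x) v := hC₂.modelDeriv_pr₁_lift hS (S.unitPair x) v
  have h₂ : modelDeriv E₂ EG S.pr₂ (S.unitPair x) (C₂.lift (S.unitPair x) v) =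
      C.lift (S.unit x) v := by
    have := hC₂.modelDeriv_pr₂_lift hS (S.unitPair x) v
    rwa [show S.pr₁ (S.unitPair x) = S.unit x from rfl, A.modelPull_unit] at this
  have := hS.eq_modelDeriv_unit h₁ h₂ hm
  rwa [C.modelDeriv_lift (hS.modelDeriv_tgt_surjective _)] at this

/-- With `w = hor v`, both `dτ w` and `hor (g^* v)` composed after `w` give the unit `du v`.
Injectivity of left translation identifies them. -/
theorem modelDeriv_inv_lift (hS : S.IsLie EX EG E₂)
    (hC₂ : DerivationOnFunctions A C C₂)
    (h : ∀ (a : S.Composable) (v : EX),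
      modelDeriv E₂ EG S.mul a (C₂.lift a v) = C.lift (S.mul a) v) (g : G) (v : EX) :
    modelDeriv EG EG S.inv g (C.lift g v) = C.lift (S.inv g) (A.modelPull g v) := by
  let a : S.Composable := ⟨(g, S.inv g), (S.tgt_inv g).symm⟩
  obtain ⟨ξ, h₁, h₂, hm⟩ := hS.exists_tangent_inv g (C.lift g v)
  have k₁ : modelDeriv E₂ EG S.pr₁ a (C₂.lift a v) = C.lift g v := hC₂.modelDeriv_pr₁_lift hS a v
  have k₂ : modelDeriv E₂ EG S.pr₂ a (C₂.lift a v) = C.lift (S.inv g) (A.modelPull g v) :=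
    hC₂.modelDeriv_pr₂_lift hS a v
  have km := h a v
  rw [show S.mul a = S.unit (S.tgt g) from S.mul_inv g, lift_unit hS hC₂ h] at km
  rw [C.modelDeriv_lift (hS.modelDeriv_tgt_surjective _)] at hm
  have e := hS.modelDeriv_pr₂_eq_zero (a := a) (ξ := ξ - C₂.lift a v)
    (by rw [map_sub, k₁]; exact sub_eq_zero.2 h₁) (by rw [map_sub, km]; exact sub_eq_zero.2 hm)
  rw [map_sub, k₂, sub_eq_zero] at e
  exact h₂.symm.trans e

/-- A connection closed under the product is multiplicative. -/
theorem isMultiplicative_of_closedUnderProduct (hS : S.IsLie EX EG E₂)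
    (hC₂ : DerivationOnFunctions A C C₂)
    (h : S.ClosedUnderProduct E₂ C.fiber) : S.IsMultiplicative EX E₂ C.fiber := by
  have h' := (hC₂.closedUnderProduct_iff hS).1 h
  have hunit := lift_unit hS hC₂ h'
  have hinv := modelDeriv_inv_lift hS hC₂ h'
  have hinv_mem (g : G) (w : EG) (hw : w ∈ C.fiber g) :
      modelDeriv EG EG S.inv g w ∈ C.fiber (S.inv g) := by
    rw [← C.lift_modelDeriv hw, hinv]; exact C.lift_mem _ _
  refine ⟨fun g => ?_, fun g => ?_, h, fun x v => ?_, fun g v hv => ?_⟩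
  -- Writing `g = k⁻¹`, the map `dτ` sends `C_k` into `C_g`, and `ds ∘ dτ = dt` is already
  -- surjective on `C_k`.
  · obtain ⟨k, rfl⟩ : ∃ k, S.inv k = g := ⟨S.inv g, S.inv_inv g⟩
    refine (Submodule.eq_top_iff').2 fun (v : EX) => ?_
    refine ⟨modelDeriv EG EG S.inv k (C.lift k v), hinv_mem k _ (C.lift_mem k v), ?_⟩
    exact (hS.modelDeriv_src_inv k _).trans
      (C.modelDeriv_lift (hS.modelDeriv_tgt_surjective k) v)
  · refine (Submodule.eq_top_iff').2 fun (v : EX) => ?_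
    exact ⟨C.lift g v, C.lift_mem g v, C.modelDeriv_lift (hS.modelDeriv_tgt_surjective g) v⟩
  · have hx : ∀ w : EX, modelDeriv EX EG S.unit x w ∈ C.fiber (S.unit x) := fun w => by
      rw [← hunit]; exact C.lift_mem _ _
    exact hx v
  · exact hinv_mem g v hv

variable [T2Space X]

/-- The exterior derivative of the horizontal form `g₁ · c(g₂)` on horizontal lifts. -/
theorem formDeriv_shift (hS : S.IsLie EX EG E₂)
    (hA : CommutesRow₀₁ A C) (hC₂ : DerivationOnFunctions A C C₂) {c : G → EX [⋀^Fin q]→L[ℝ] ℝ}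
    (hc : ∀ g, ContMDiffAt 𝓘(ℝ, EG) 𝓘(ℝ, EX [⋀^Fin q]→L[ℝ] ℝ) ∞ (cochainCoord S.tgt c g) g)
    (a : S.Composable) (v : Fin (q + 1) → EX) :
    FormDifferentiableAt (fun b => (c (S.pr₂ b)).compContinuousLinearMap
      (A.modelPull (S.pr₁ b) ∘L modelDeriv E₂ EX S.tgt₂ b)) a ∧
    formDeriv (fun b => (c (S.pr₂ b)).compContinuousLinearMap
      (A.modelPull (S.pr₁ b) ∘L modelDeriv E₂ EX S.tgt₂ b)) a (fun i => C₂.lift a (v i)) =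
    formDeriv (fun z => (c z).compContinuousLinearMap (modelDeriv EG EX S.tgt z)) (S.pr₂ a)
      (fun i => C.lift (S.pr₂ a) (A.modelPull (S.pr₁ a) (v i))) := by
  -- Compatibility of the action only concerns forms coming from `X`, so `c` is replaced by such a
  -- form up to a remainder vanishing at `pr₂ a`.
  obtain ⟨α, hα, hαc⟩ := exists_isSmoothCochain_eq (S.tgt (S.pr₂ a)) (c (S.pr₂ a))
  have hα' (x : X) := formDifferentiableAt_of_smooth hα x
  have hsrc (g : G) : ContinuousAt S.src g := hS.contMDiff_src.continuous.continuousAt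
  have htgt (g : G) : ContinuousAt S.tgt g := hS.contMDiff_tgt.continuous.continuousAt
  -- the difference of `c` and the pullback of `α`, which vanishes at the point of interest
  set c' : G → EX [⋀^Fin q]→L[ℝ] ℝ := fun g => c g - α (S.tgt g) with hc'
  have hc'd (g : G) : MDifferentiableAt 𝓘(ℝ, EG) 𝓘(ℝ, EX [⋀^Fin q]→L[ℝ] ℝ)
      (cochainCoord S.tgt c' g) g := by
    have h1 : MDifferentiableAt 𝓘(ℝ, EG) 𝓘(ℝ, EX [⋀^Fin q]→L[ℝ] ℝ)
        (cochainCoord (fun x => x) α (S.tgt g) ∘ S.tgt) g :=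
      ((hα _).mdifferentiableAt (by simp)).comp g (hS.mdifferentiableAt_tgt g)
    exact ((hc g).mdifferentiableAt (by simp)).sub h1
  have hc'0 : c' (S.pr₂ a) = 0 := by rw [hc']; simp only [hαc, sub_self]
  have hsp : S.tgt ∘ S.pr₂ = S.src ∘ S.pr₁ := funext fun b => (S.src_pr₁ b).symm
  -- the forms on the groupoid
  set ψ : G → EG [⋀^Fin q]→L[ℝ] ℝ := fun z => (α (S.src z)).compContinuousLinearMap
    (A.modelPull z ∘L modelDeriv EG EX S.tgt z) with hψ
  set θ : G → EG [⋀^Fin q]→L[ℝ] ℝ := fun z => (α (S.tgt z)).compContinuousLinearMap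
    (modelDeriv EG EX S.tgt z) with hθ
  have hψd (g : G) : FormDifferentiableAt ψ g := by
    refine formDifferentiableAt_comp (hsrc g) ?_
      (mdifferentiableAt_bundleMapCoord_modelPull A hS contMDiff_id g)
    exact ((hα _).mdifferentiableAt (by simp)).comp g (hS.mdifferentiableAt_src g)
  have hθd (g : G) : FormDifferentiableAt θ g := (hα' _).pullback hS.contMDiff_tgt
  have hθv (g : G) (w : Fin (q + 1) → EX) :
      formDeriv θ g (fun i => C.lift g (w i)) = formDeriv α (S.tgt g) w := by
    rw [hθ, formDeriv_pullback hS.contMDiff_tgt (hα' _)]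
    refine congrArg (formDeriv α (S.tgt g)) (funext fun i => ?_)
    exact C.modelDeriv_lift (hS.modelDeriv_tgt_surjective g) _
  have hψv (g : G) (w : Fin (q + 1) → EX) :
      formDeriv ψ g (fun i => C.lift g (w i)) =
        formDeriv α (S.src g) (fun i => A.modelPull g (w i)) := by
    -- Compatibility computes `d` of `ψ - θ`; the contribution of `θ = t^*α` is known from
    -- naturality and cancels.
    have h1 := hA.formDeriv_eq hα g w
    have h2 : (fun z => ((α (S.src z)).compContinuousLinearMap (A.modelPull z) -
        α (S.tgt z)).compContinuousLinearMap (modelDeriv EG EX S.tgt z)) = fun z => ψ z - θ z := rfl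
    rw [h2, formDeriv_sub (hψd g) (hθd g), ContinuousAlternatingMap.sub_apply, hθv,
      sub_left_inj] at h1
    exact h1
  -- decompose the form on composable pairs
  have hBd : MDifferentiableAt 𝓘(ℝ, E₂) 𝓘(ℝ, E₂ →L[ℝ] EX) (bundleMapCoord E₂ (S.tgt ∘ S.pr₂)
      (fun b => A.modelPull (S.pr₁ b) ∘L modelDeriv E₂ EX S.tgt₂ b) a) a := by
    rw [hsp]
    exact mdifferentiableAt_bundleMapCoord_modelPull A hS hS.contMDiff_pr₁ a
  have hcont : ContinuousAt (S.tgt ∘ S.pr₂) a :=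
    (hS.contMDiff_tgt.comp hS.contMDiff_pr₂).continuous.continuousAt
  have hcd : MDifferentiableAt 𝓘(ℝ, E₂) 𝓘(ℝ, EX [⋀^Fin q]→L[ℝ] ℝ)
      (cochainCoord (S.tgt ∘ S.pr₂) (c' ∘ S.pr₂) a) a :=
    (hc'd _).comp a (hS.mdifferentiableAt_pr₂ a)
  have hβ := formDifferentiableAt_comp hcont hcd hBd
  have hπ : FormDifferentiableAt (fun b => (ψ (S.pr₁ b)).compContinuousLinearMap
    (modelDeriv E₂ EG S.pr₁ b)) a := (hψd _).pullback hS.contMDiff_pr₁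
  have hdec : (fun b => (c (S.pr₂ b)).compContinuousLinearMap
      (A.modelPull (S.pr₁ b) ∘L modelDeriv E₂ EX S.tgt₂ b)) = fun b =>
      ((c' ∘ S.pr₂) b).compContinuousLinearMap
        (A.modelPull (S.pr₁ b) ∘L modelDeriv E₂ EX S.tgt₂ b) +
      (ψ (S.pr₁ b)).compContinuousLinearMap (modelDeriv E₂ EG S.pr₁ b) := by
    funext b
    ext w
    have e : modelDeriv E₂ EX S.tgt₂ b =
      modelDeriv EG EX S.tgt (S.pr₁ b) ∘L modelDeriv E₂ EG S.pr₁ b :=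
      ContinuousLinearMap.ext (hS.modelDeriv_tgt₂ b)
    simp only [hc', hψ, Function.comp_apply, ContinuousAlternatingMap.add_apply,
      ContinuousAlternatingMap.compContinuousLinearMap_apply, ContinuousAlternatingMap.sub_apply, e,
      ← S.src_pr₁ b]
    exact (sub_add_cancel _ _).symm
  have hdec' : (fun z => (c z).compContinuousLinearMap (modelDeriv EG EX S.tgt z)) = fun z =>
      (c' z).compContinuousLinearMap (modelDeriv EG EX S.tgt z) + θ z := by
    funext z
    ext w
    simp [hc', hθ]
  refine ⟨hdec ▸ hβ.add hπ, ?_⟩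
  have hβ' := formDifferentiableAt_comp (htgt (S.pr₂ a)) (hc'd _)
    (mdifferentiableAt_bundleMapCoord_modelDeriv hS.contMDiff_tgt (S.pr₂ a))
  rw [hdec, hdec', formDeriv_add hβ hπ, formDeriv_add hβ' (hθd _),
    ContinuousAlternatingMap.add_apply, ContinuousAlternatingMap.add_apply, hθv,
    formDeriv_pullback hS.contMDiff_pr₁ (hψd _), ContinuousAlternatingMap.compContinuousLinearMap_apply]
  congr 1
  -- Remainder part: since `c'` vanishes here, no derivative of the action enters. Both sides are
  -- alternating sums of derivatives of `c'` along `hor (g₁^* v)`.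
  · rw [formDeriv_comp_of_eq_zero hcont hcd hBd hc'0, formDeriv_comp_of_eq_zero (htgt _) (hc'd _)
      (mdifferentiableAt_bundleMapCoord_modelDeriv hS.contMDiff_tgt _) hc'0]
    refine Finset.sum_congr rfl fun i _ => ?_
    have h1 : modelDeriv E₂ (EX [⋀^Fin q]→L[ℝ] ℝ) (cochainCoord (S.tgt ∘ S.pr₂) (c' ∘ S.pr₂) a) a
        (C₂.lift a (v i)) = modelDeriv EG (EX [⋀^Fin q]→L[ℝ] ℝ) (cochainCoord S.tgt c' (S.pr₂ a))
          (S.pr₂ a) (C.lift (S.pr₂ a) (A.modelPull (S.pr₁ a) (v i))) := by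
      rw [← hC₂.modelDeriv_pr₂_lift hS]
      exact modelDeriv_comp_apply a (hc'd _) (hS.mdifferentiableAt_pr₂ a) _
    rw [h1]
    congr 2
    funext j
    simp only [Fin.removeNth, ContinuousLinearMap.comp_apply]
    rw [hC₂.modelDeriv_tgt₂_lift hS, C.modelDeriv_lift (hS.modelDeriv_tgt_surjective _)]
  · have h1 : (modelDeriv E₂ EG S.pr₁ a ∘ fun i => C₂.lift a (v i)) =
        fun i => C.lift (S.pr₁ a) (v i) := funext fun i => hC₂.modelDeriv_pr₁_lift hS a (v i)
    rw [h1, hψv, S.src_pr₁]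

/-- The last two terms of `δc` are pullbacks along `mul` and `pr₁`, and the first is
`formDeriv_shift`. The result differs from `δ₁_d_apply` only in the vectors at `mul a`. -/
theorem formDeriv_δ₁ (hS : S.IsLie EX EG E₂)
    (hA : CommutesRow₀₁ A C) (hC₂ : DerivationOnFunctions A C C₂) {c : G → EX [⋀^Fin q]→L[ℝ] ℝ}
    (hc : ∀ g, ContMDiffAt 𝓘(ℝ, EG) 𝓘(ℝ, EX [⋀^Fin q]→L[ℝ] ℝ) ∞ (cochainCoord S.tgt c g) g)
    (a : S.Composable) (v : Fin (q + 1) → EX) :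
    C₂.d (A.δ₁ c) a v =
      formDeriv (fun z => (c z).compContinuousLinearMap (modelDeriv EG EX S.tgt z)) (S.pr₂ a)
        (fun i => C.lift (S.pr₂ a) (A.modelPull (S.pr₁ a) (v i))) -
      formDeriv (fun z => (c z).compContinuousLinearMap (modelDeriv EG EX S.tgt z)) (S.mul a)
        (fun i => modelDeriv E₂ EG S.mul a (C₂.lift a (v i))) +
      formDeriv (fun z => (c z).compContinuousLinearMap (modelDeriv EG EX S.tgt z)) (S.pr₁ a)
        (fun i => C.lift (S.pr₁ a) (v i)) := by
  set η : G → EG [⋀^Fin q]→L[ℝ] ℝ :=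
    fun z => (c z).compContinuousLinearMap (modelDeriv EG EX S.tgt z) with hη
  have hηd (g : G) : FormDifferentiableAt η g :=
    formDifferentiableAt_comp hS.contMDiff_tgt.continuous.continuousAt
      ((hc g).mdifferentiableAt (by simp))
      (mdifferentiableAt_bundleMapCoord_modelDeriv hS.contMDiff_tgt g)
  obtain ⟨h₁, h₁v⟩ := formDeriv_shift hS hA hC₂ hc a v
  have h₂ : FormDifferentiableAt (fun b => (η (S.mul b)).compContinuousLinearMap
    (modelDeriv E₂ EG S.mul b)) a := (hηd _).pullback hS.mul_smooth
  have h₃ : FormDifferentiableAt (fun b => (η (S.pr₁ b)).compContinuousLinearMap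
    (modelDeriv E₂ EG S.pr₁ b)) a := (hηd _).pullback hS.contMDiff_pr₁
  let D : S.Composable → EX [⋀^Fin q]→L[ℝ] ℝ := A.δ₁ c
  have hdec : (fun b => (D b).compContinuousLinearMap
      (modelDeriv E₂ EX S.tgt₂ b)) = fun b => (c (S.pr₂ b)).compContinuousLinearMap
        (A.modelPull (S.pr₁ b) ∘L modelDeriv E₂ EX S.tgt₂ b) -
      (η (S.mul b)).compContinuousLinearMap (modelDeriv E₂ EG S.mul b) +
      (η (S.pr₁ b)).compContinuousLinearMap (modelDeriv E₂ EG S.pr₁ b) := by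
    funext b
    ext w
    have e₁ : (fun i => modelDeriv E₂ EX S.tgt₂ b (w i)) =
      fun i => modelDeriv EG EX S.tgt (S.pr₁ b) (modelDeriv E₂ EG S.pr₁ b (w i)) :=
      funext fun i => hS.modelDeriv_tgt₂ b _
    have e₂ : (fun i => modelDeriv E₂ EX S.tgt₂ b (w i)) =
      fun i => modelDeriv EG EX S.tgt (S.mul b) (modelDeriv E₂ EG S.mul b (w i)) :=
      funext fun i => (hS.modelDeriv_tgt₂ b _).trans (hS.modelDeriv_tgt_mul b _).symm
    refine (A.δ₁_apply c b (fun i => modelDeriv E₂ EX S.tgt₂ b (w i))).trans ?_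
    exact congrArg₂ (fun r s : ℝ => c (S.pr₂ b)
      (fun i => A.modelPull (S.pr₁ b) (modelDeriv E₂ EX S.tgt₂ b (w i))) - r + s)
        (congrArg (c (S.mul b)) e₂) (congrArg (c (S.pr₁ b)) e₁)
  refine (C₂.d_apply (A.δ₁ c) a v).trans ?_
  refine (congrArg (fun ζ => formDeriv ζ a (fun i => C₂.lift a (v i))) hdec).trans ?_
  rw [formDeriv_add (h₁.sub h₂) h₃, formDeriv_sub h₁ h₂, ContinuousAlternatingMap.add_apply,
    ContinuousAlternatingMap.sub_apply, h₁v, formDeriv_pullback hS.mul_smooth (hηd _),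
    formDeriv_pullback hS.contMDiff_pr₁ (hηd _)]
  refine congrArg₂ (fun r s : ℝ => _ - r + s) rfl (congrArg (formDeriv η (S.pr₁ a)) ?_)
  exact funext fun i => hC₂.modelDeriv_pr₁_lift hS a (v i)

/-- `δ` and `d` commute on `1`-cochains if and only if horizontal lifts are closed under the
product. -/
theorem commutesRow₁₂_iff (hS : S.IsLie EX EG E₂)
    (hA : CommutesRow₀₁ A C) (hC₂ : DerivationOnFunctions A C C₂) :
    CommutesRow₁₂ A C C₂ ↔ ∀ (a : S.Composable) (v : EX),
      modelDeriv E₂ EG S.mul a (C₂.lift a v) = C.lift (S.mul a) v := by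
  constructor
  · intro h a v
    -- Degree 0 suffices: for a function `f` the outer terms cancel, leaving `df` on the two vectors
    -- at `mul a`.
    refine eq_of_forall_modelDeriv_eq (x := S.mul a) fun f hf => ?_
    let c : G → EX [⋀^Fin 0]→L[ℝ] ℝ :=
      fun z => ContinuousAlternatingMap.constOfIsEmpty ℝ EX (Fin 0) (f z)
    have hc := contMDiffAt_cochainCoord_constOfIsEmpty (EX := EX) S.tgt hf
    have h1 : @Eq ℝ (C₂.d (A.δ₁ c) a (fun _ => v)) (A.δ₁ (C.d c) a (fun _ => v)) :=
      congrArg (fun k : S.Composable → EX [⋀^Fin 1]→L[ℝ] ℝ => k a (fun _ => v)) (h 0 c hc)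
    have h2 := ((formDeriv_δ₁ hS hA hC₂ hc a (fun _ => v)).symm.trans h1).trans
      (δ₁_d_apply A C c a (fun _ => v))
    have e : (fun z => (c z).compContinuousLinearMap (modelDeriv EG EX S.tgt z)) =
      fun z => ContinuousAlternatingMap.constOfIsEmpty ℝ EG (Fin 0) (f z) := rfl
    rw [add_left_inj, sub_right_inj] at h2
    have hfd := (hf (S.mul a)).mdifferentiableAt (by simp)
    exact ((formDeriv_constOfIsEmpty f (S.mul a) _ hfd).symm.trans h2).trans
      (formDeriv_constOfIsEmpty f (S.mul a) _ hfd)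
  · intro h q c hc
    funext a
    refine ContinuousAlternatingMap.ext fun v => ?_
    refine (formDeriv_δ₁ hS hA hC₂ hc a v).trans (Eq.trans ?_ (δ₁_d_apply A C c a v).symm)
    exact congrArg (fun w : Fin (q + 1) → EG => _ - formDeriv (fun z =>
      (c z).compContinuousLinearMap (modelDeriv EG EX S.tgt z)) (S.mul a) w + _)
        (funext fun i => h a (v i))

end GroupoidOn

end

/-! ### The main theorem. -/

theorem mainTheorem9
    {EX : Type*} [NormedAddCommGroup EX] [NormedSpace ℝ EX] [FiniteDimensional ℝ EX]
    {EG : Type*} [NormedAddCommGroup EG] [NormedSpace ℝ EG] [FiniteDimensional ℝ EG]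
    {E₂ : Type*} [NormedAddCommGroup E₂] [NormedSpace ℝ E₂] [FiniteDimensional ℝ E₂]
    {X : Type*} [TopologicalSpace X] [T2Space X] [ChartedSpace EX X] [IsManifold 𝓘(ℝ, EX) ∞ X]
    {G : Type*} [TopologicalSpace G] [T2Space G] [ChartedSpace EG G] [IsManifold 𝓘(ℝ, EG) ∞ G]
    (S : GroupoidOn X G)
    [ChartedSpace E₂ S.Composable] [IsManifold 𝓘(ℝ, E₂) ∞ S.Composable]
    (hS : S.IsLie EX EG E₂)
    (A : S.TangentAction EX EG)
    (C : EhresmannConnection EG EX S.tgt)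
    (C₂ : EhresmannConnection E₂ EX S.tgt₂)
    (hA : GroupoidOn.CommutesRow₀₁ A C)
    (hC₂ : GroupoidOn.DerivationOnFunctions A C C₂) :
    (∀ (a : S.Composable) (ξ : TangentSpace 𝓘(ℝ, E₂) a), ξ ∈ C₂.fiber a ↔
      mfderiv 𝓘(ℝ, E₂) 𝓘(ℝ, EG) S.pr₁ a ξ ∈ C.fiber (S.pr₁ a) ∧
      mfderiv 𝓘(ℝ, E₂) 𝓘(ℝ, EG) S.pr₂ a ξ ∈ C.fiber (S.pr₂ a)) ∧
    (GroupoidOn.CommutesRow₁₂ A C C₂ ↔ S.IsMultiplicative EX E₂ C.fiber) ∧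
    (GroupoidOn.CommutesRow₁₂ A C C₂ ↔ S.ClosedUnderProduct E₂ C.fiber) := by
  have h : GroupoidOn.CommutesRow₁₂ A C C₂ ↔ S.ClosedUnderProduct E₂ C.fiber :=
    (GroupoidOn.commutesRow₁₂_iff hS hA hC₂).trans (hC₂.closedUnderProduct_iff hS).symm
  refine ⟨fun a ξ => hC₂.mem_fiber_iff hS a ξ, h.trans ⟨fun hm => ?_, fun hm => hm.mul_mem⟩, h⟩
  exact GroupoidOn.isMultiplicative_of_closedUnderProduct hS hC₂ hm
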